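/- **Setting.** Let $g\ge 1$ and let $\pi_1$ be the fundamental group of a compact oriented surface of genus $g$ with one boundary component: the free group on $\mathbf u_1,\mathbf v_1,\dots,\mathbf u_g,\mathbf v_g$, with boundary word $\partial=\prod_{i=1}^g[\mathbf u_i,\mathbf v_i]$. By Dehn–Nielsen the mapping class group is $\mathcal M_{g,1}=\{\varphi\in\mathrm{Aut}(\pi_1):\varphi(\partial)=\partial\}$. Put $\Gamma_0=\pi_1$, $\Gamma_{k+1}=[\Gamma_k,\pi_1]$, and let $\mathcal M_{g,1}[m]$ be the subgroup of those $\varphi\in\mathcal M_{g,1}$ that act trivially on $\pi_1/\Gamma_m$. Let $H=H_1(\pi_1;\mathbb Q)$, write $x=[\mathbf x]\in H$ for the class of $\mathbf x\in\pi_1$, let $\widehat T=\prod_{n\ge0}H^{\otimes n}$, and let $\mathcal L_n\subset H^{\otimes n}$ be the degree $n$ part of the free Lie algebra on $H$. *Johnson homomorphism.* For $\varphi\in\mathcal M_{g,1}[m]$, $\tau_m(\varphi)\in\mathrm{Hom}(H,\mathcal L_{m+1})$ is the linear map that sends $[\mathbf x]$ to the class of $\varphi(\mathbf x)\mathbf x^{-1}$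 under $\Gamma_m\to\Gamma_m/\Gamma_{m+1}\to\mathcal L_{m+1}$ (Magnus: commutators go to Lie brackets, and $\Gamma_0\to\mathcal L_1=H$ is $\mathbf x\mapsto[\mathbf x]$). *Marked fatgraphs.* A trivalent bordered fatgraph $G$ of genus $g$ is a connected finite graph with cyclic orderings of the half-edges at its vertices, one boundary cycle (an oriented edge pointing to $v$ is followed by the outgoing orientation of the next edge at $v$), $\chi(G)=1-2g$, one univalent vertex, and all other vertices trivalent; the tail $\mathbf t$ is the edge at the univalent vertex, oriented away from it. A marking of $G$ assigns to every oriented edge $\mathbf e$ an element of $\pi_1$, also denoted $\mathbf e$, such that $\bar{\mathbf e}\,\mathbf e=1$; $\mathbf e_1\mathbf e_2\mathbf e_3=1$ for the cyclically ordered oriented edges pointing to any trivalent vertex; these elements generate $\pi_1$; and $\bar{\mathbf t}=\partial$. For $\varphi\in\mathcal M_{g,1}$, $\varphi(G)$ is $G$ with its marking composed with $\varphi$. A (marked) Whitehead move $G\to G'$ collapses a non-tail edge with distinct endpoints and expands the resulting four-valent vertex in the other possible way, keeping the marking of all other edges. *Fatgraph Magnus expansion.* Let $h(X,Y)=\log(e^Xe^Y)-X-Y$.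 For oriented edges $\mathbf x$ of $G$ define $\ell^G(\mathbf x)=\sum_n\ell^G_n(\mathbf x)\in\widehat T$ recursively by $\ell^G_0(\mathbf x)=0$, $\ell^G_1(\mathbf x)=x$ and, for $n\ge2$, $$\ell^G_n(\mathbf x)=-\tfrac13\sum_{i=1}^r h\big(\ell^G(\mathbf f_{i-1}),-\ell^G(\mathbf f_i)\big)_{(n)}$$ if the edge-path $\mathbf x=\mathbf f_0,\mathbf f_1,\dots,\mathbf f_r=\bar{\mathbf x}$ along the boundary cycle does not pass through the univalent vertex, and $\ell^G_n(\mathbf x)=-\ell^G_n(\bar{\mathbf x})$ otherwise. The fatgraph Magnus expansion $\theta^G=\sum_n\theta^G_n$, with $\theta^G_n(\mathbf x)\in H^{\otimes n}$, is the homomorphism from $\pi_1$ to the multiplicative group $1+\prod_{n\ge1}H^{\otimes n}$ with $\theta^G_1(\mathbf x)=x$ for all $\mathbf x\in\pi_1$ and $\theta^G(\mathbf e)=\exp(\ell^G(\mathbf e))$ for all oriented edges $\mathbf e$ of $G$. **Corollary 4.3.** Let $m\ge1$, let $\varphi\in\mathcal M_{g,1}[m]$, and let $G=G_0\to G_1\to\dots\to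 G_k=\varphi(G)$ be a sequence of Whitehead moves of marked trivalent bordered fatgraphs of genus $g$ (the last equality up to isomorphism of marked fatgraphs). Then $\tau_m(\varphi)$ and $\theta^{G_0},\dots,\theta^{G_k}$ are well defined (they exist and are unique), and for all $\mathbf x\in\pi_1$ $$\tau_m(\varphi)(x)=\sum_{i=1}^k\big(\theta^{G_{i-1}}_{m+1}(\mathbf x)-\theta^{G_i}_{m+1}(\mathbf x)\big)\in H^{\otimes(m+1)}.$$ -/

import Mathlib

open scoped TensorProduct commutatorElement

noncomputable section

namespace FatgraphJohnson

/-! Exponential, logarithm and Hausdorff series of noncommutative power series -/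

section Series

variable {A : Type*} [Ring A] [Algebra ℚ A]

/-- `exp f = ∑ₖ fᵏ / k!`, for a power series `f` without constant term (so that `fᵏ` does not
contribute to the coefficients of degree `n < k`). -/
def expSeries (f : PowerSeries A) : PowerSeries A :=
  PowerSeries.mk fun n =>
    ∑ k ∈ Finset.range (n + 1), ((k.factorial : ℚ)⁻¹) • PowerSeries.coeff n (f ^ k)

/-- `log f = ∑ₖ (-1)ᵏ⁺¹ (f - 1)ᵏ / k`, for a power series `f` with constant term `1`. -/
def logSeries (f : PowerSeries A) : PowerSeries A :=
  PowerSeries.mk fun n =>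
    ∑ k ∈ Finset.Icc 1 n, ((-1 : ℚ) ^ (k + 1) / (k : ℚ)) • PowerSeries.coeff n ((f - 1) ^ k)

/-- The nonlinear part of the Hausdorff series: `h(X, Y) = log (exp X * exp Y) - X - Y`. -/
def hausdorff (X Y : PowerSeries A) : PowerSeries A :=
  logSeries (expSeries X * expSeries Y) - X - Y

end Series

/-! The surface group, the mapping class group and the Torelli groups -/

/-- The fundamental group of a surface of genus `g` with one boundary component: the free group
on `u₁, …, u_g` (left summand) and `v₁, …, v_g` (right summand). -/
abbrev SurfaceGroup (g : ℕ) : Type := FreeGroup (Fin g ⊕ Fin g)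

/-- The boundary word `∂ = [u₁, v₁] [u₂, v₂] ⋯ [u_g, v_g]`. -/
def boundaryWord (g : ℕ) : SurfaceGroup g :=
  (List.ofFn fun i : Fin g => ⁅(FreeGroup.of (Sum.inl i) : SurfaceGroup g), (FreeGroup.of (Sum.inr i) : SurfaceGroup g)⁆).prod

/-- The mapping class group (Dehn-Nielsen): automorphisms of the surface group that fix `∂`. -/
def mappingClassGroup (g : ℕ) : Subgroup (MulAut (SurfaceGroup g)) :=
  MulAction.stabilizer (MulAut (SurfaceGroup g)) (boundaryWord g)

/-- The `k`-th Torelli group: mapping classes acting trivially on `N_k = π₁ / Γ_k`, where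
`Γ_0 = π₁` and `Γ_{k+1} = [Γ_k, π₁]`. -/
def torelli (g k : ℕ) : Subgroup (mappingClassGroup g) where
  carrier := {φ | ∀ x : SurfaceGroup g,
    ((φ.1 x : SurfaceGroup g) : SurfaceGroup g ⧸ (⊤ : Subgroup (SurfaceGroup g)).lowerCentralSeries k) =
      ((x : SurfaceGroup g) : SurfaceGroup g ⧸ (⊤ : Subgroup (SurfaceGroup g)).lowerCentralSeries k)}
  one_mem' := fun _ => rfl
  mul_mem' := fun {φ ψ} hφ hψ x => (hφ (ψ.1 x)).trans (hψ x)
  inv_mem' := fun {φ} hφ x => by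
    have h := hφ (φ.1⁻¹ x)
    rw [MulAut.apply_inv_self] at h
    exact h.symm

/-- Rational homology `H = H₁(Σ; ℚ)`. -/
abbrev Homology (g : ℕ) : Type := ℚ ⊗[ℤ] Additive (Abelianization (SurfaceGroup g))

/-- The homology class `[x] ∈ H` of `x ∈ π₁`. -/
def homologyClass {g : ℕ} (x : SurfaceGroup g) : Homology g :=
  (1 : ℚ) ⊗ₜ[ℤ] Additive.ofMul (Abelianization.of x)

/-- The tensor algebra `T = ⨁ₙ H^{⊗ n}`; its summand `H^{⊗ n}` is `LinearMap.range ι ^ n`, where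
`ι : H → T` is the inclusion. -/
abbrev Tensors (g : ℕ) : Type := TensorAlgebra ℚ (Homology g)

/-- The completed tensor algebra `∏ₙ H^{⊗ n}` is realized inside the power series ring `T⟦X⟧`, as
the subring of all `∑ₙ tₙ Xⁿ` with `tₙ ∈ H^{⊗ n}` (see `IsHomogeneous`): the `n`-th coefficient
is the graded component of degree `n`. -/
abbrev TensorSeries (g : ℕ) : Type := PowerSeries (Tensors g)

/-- `f` belongs to the completed tensor algebra: its `n`-th coefficient lies in `H^{⊗ n}`. -/
def IsHomogeneous {g : ℕ} (f : TensorSeries g) : Prop :=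
  ∀ n : ℕ, PowerSeries.coeff n f ∈
    (LinearMap.range (TensorAlgebra.ι ℚ (M := Homology g)) : Submodule ℚ (Tensors g)) ^ n

/-- Generalized Magnus expansions: homomorphisms from `π₁` to the multiplicative group
`1 + T̂₁` of the completed tensor algebra `T̂` such that `θ(x) = 1 + [x] + θ₂(x) + θ₃(x) + ⋯`. -/
structure IsMagnusExpansion {g : ℕ} (θ : SurfaceGroup g →* TensorSeries g) : Prop where
  homogeneous : ∀ x, IsHomogeneous (θ x)
  coeff_zero : ∀ x, PowerSeries.coeff 0 (θ x) = 1
  coeff_one : ∀ x, PowerSeries.coeff 1 (θ x) = TensorAlgebra.ι ℚ (homologyClass x)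

/-! The Johnson homomorphisms -/

/-- `IsLieClass k x u` says that `x ∈ Γ_k` and that `u ∈ 𝓛_{k+1} ⊆ H^{⊗ (k+1)}` is the image of `x`
under the Magnus map `Γ_k → Γ_k / Γ_{k+1} → 𝓛_{k+1}` to the free Lie algebra `𝓛` on `H`.
These maps are the homomorphisms that send `x ∈ Γ_0` to `[x]` and turn group commutators
`[x, y]`, with `x ∈ Γ_k` and `y ∈ π₁`, into Lie brackets. -/
inductive IsLieClass {g : ℕ} : ℕ → SurfaceGroup g → Tensors g → Prop
  | of (x : SurfaceGroup g) : IsLieClass 0 x (TensorAlgebra.ι ℚ (homologyClass x))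
  | commutator {k : ℕ} {x : SurfaceGroup g} {u : Tensors g} (y : SurfaceGroup g) :
      IsLieClass k x u → IsLieClass (k + 1) ⁅x, y⁆ ⁅u, TensorAlgebra.ι ℚ (homologyClass y)⁆
  | mul {k : ℕ} {x y : SurfaceGroup g} {u v : Tensors g} :
      IsLieClass k x u → IsLieClass k y v → IsLieClass k (x * y) (u + v)
  | inv {k : ℕ} {x : SurfaceGroup g} {u : Tensors g} :
      IsLieClass k x u → IsLieClass k x⁻¹ (-u)

/-- `τ : H → 𝓛_{m+1} ⊆ T` is the `m`-th Johnson homomorphism evaluated at `φ`: for all `x ∈ π₁`,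
`τ [x]` is the class of `φ(x) x⁻¹` in `Γ_m / Γ_{m+1} → 𝓛_{m+1}`. -/
def IsJohnson {g : ℕ} (m : ℕ) (φ : mappingClassGroup g) (τ : Homology g →ₗ[ℚ] Tensors g) : Prop :=
  ∀ x : SurfaceGroup g, IsLieClass m (φ.1 x * x⁻¹) (τ (homologyClass x))

/-- The value `τ_m(φ)` of the `m`-th Johnson homomorphism at `φ`, that is, the unique
`τ` with `IsJohnson m φ τ`. -/
def johnson {g : ℕ} (m : ℕ) (φ : mappingClassGroup g) : Homology g →ₗ[ℚ] Tensors g :=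
  Classical.epsilon (IsJohnson m φ)

/-! Trivalent marked bordered fatgraphs -/

/-- A trivalent once-bordered fatgraph of genus `g` with a `π`-marking, given by its finite set
`Dart` of oriented edges. A dart is regarded as pointing towards its end vertex, so that the
vertices are the cycles of `rot`, the cyclic ordering of the darts pointing to a vertex. -/
structure MarkedFatgraph (g : ℕ) where
  Dart : Type
  finite_dart : Finite Dart
  /-- orientation reversal -/
  bar : Equiv.Perm Dart
  bar_bar : ∀ e, bar (bar e) = e
  bar_ne : ∀ e, bar e ≠ e
  /-- the next dart in the cyclic order at the vertex that a dart points to -/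
  rot : Equiv.Perm Dart
  /-- the tail, oriented away from its univalent vertex -/
  tail : Dart
  /-- there is exactly one univalent vertex, and the tail is the edge incident to it -/
  univalent_iff : ∀ e, rot e = e ↔ e = bar tail
  /-- all other vertices are trivalent -/
  trivalent : ∀ e, e ≠ bar tail → rot (rot (rot e)) = e
  /-- there is exactly one boundary cycle (it consists of all darts), a dart pointing
  to `v` being followed by the outgoing orientation of the next one at `v`; in particular the
  graph is connected -/
  one_boundary : ∀ e, ∃ n : ℕ, ((rot.trans bar) ^ n) tail = e
  /-- gluing a disk to the boundary cycle gives a closed surface of genus `g`: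
  `V - E + 1 = 2 - 2g` -/
  genus : (Nat.card (Quotient (Equiv.Perm.SameCycle.setoid rot)) : ℤ)
    - Nat.card (Quotient (Equiv.Perm.SameCycle.setoid bar)) + 1 = 2 - 2 * (g : ℤ)
  /-- the `π`-marking -/
  mark : Dart → SurfaceGroup g
  mark_bar : ∀ e, mark (bar e) * mark e = 1
  /-- vertex compatibility at the trivalent vertices -/
  mark_vertex : ∀ e, e ≠ bar tail → mark e * mark (rot e) * mark (rot (rot e)) = 1
  /-- full rank -/
  mark_full : Subgroup.closure (Set.range mark) = ⊤
  /-- geometricity -/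
  mark_tail : mark (bar tail) = boundaryWord g

namespace MarkedFatgraph

variable {g : ℕ}

/-- The fatgraph `φ(G)`: the same fatgraph, with marking post-composed with `φ`. -/
def act (φ : mappingClassGroup g) (G : MarkedFatgraph g) : MarkedFatgraph g :=
  { G with
    mark := fun e => φ.1 (G.mark e)
    mark_bar := fun e => by rw [← map_mul, G.mark_bar, map_one]
    mark_vertex := fun e he => by rw [← map_mul, ← map_mul, G.mark_vertex e he, map_one]
    mark_full := by
      have h : Set.range (fun e => φ.1 (G.mark e)) =
          (φ.1 : SurfaceGroup g →* SurfaceGroup g) '' Set.range G.mark := by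
        rw [← Set.range_comp]; rfl
      rw [h, ← MonoidHom.map_closure, G.mark_full]
      exact Subgroup.map_top_of_surjective _ φ.1.surjective
    mark_tail := by
      rw [G.mark_tail]
      exact φ.2 }

/-- Isomorphism of marked fatgraphs. -/
def Iso (G G' : MarkedFatgraph g) : Prop :=
  ∃ ψ : G.Dart ≃ G'.Dart,
    (∀ x, ψ (G.bar x) = G'.bar (ψ x)) ∧
    (∀ x, ψ (G.rot x) = G'.rot (ψ x)) ∧
    (∀ x, G'.mark (ψ x) = G.mark x)

/-- `G → G'` is a marked Whitehead move along the non-tail edge `e` of `G`, which has distinct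
endpoints. With the vertices of `e` and `ē` having cyclic orders `(e, a, b)` and `(ē, c, d)`,
collapsing `e` creates a four-valent vertex with cyclic order `(a, b, c, d)`. It is expanded in
the other way, into vertices `(f, b, c)` and `(f̄, d, a)`; the rest of the fatgraph and the
markings of all oriented edges other than `e`, `ē` stay the same. The bijection `ψ` matches the
oriented edges of `G` with those of `G'`, with `e` corresponding to `f`. -/
def IsWhiteheadMove (G G' : MarkedFatgraph g) : Prop :=
  ∃ (e a b c d : G.Dart) (ψ : G.Dart ≃ G'.Dart),
    e ≠ G.tail ∧ e ≠ G.bar G.tail ∧ ¬ G.rot.SameCycle e (G.bar e) ∧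
    (G.rot e = a ∧ G.rot a = b ∧ G.rot b = e) ∧
    (G.rot (G.bar e) = c ∧ G.rot c = d ∧ G.rot d = G.bar e) ∧
    (∀ x, ψ (G.bar x) = G'.bar (ψ x)) ∧
    (G'.rot (ψ e) = ψ b ∧ G'.rot (ψ b) = ψ c ∧ G'.rot (ψ c) = ψ e) ∧
    (G'.rot (ψ (G.bar e)) = ψ d ∧ G'.rot (ψ d) = ψ a ∧ G'.rot (ψ a) = ψ (G.bar e)) ∧
    (∀ x, ¬ G.rot.SameCycle e x → ¬ G.rot.SameCycle (G.bar e) x →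
      G'.rot (ψ x) = ψ (G.rot x)) ∧
    (∀ x, x ≠ e → x ≠ G.bar e → G'.mark (ψ x) = G.mark x)

/-- The `j`-th oriented edge of the boundary cycle, starting with the tail as the `0`-th one. -/
def boundaryEdge (G : MarkedFatgraph g) (j : ℕ) : G.Dart :=
  ((G.rot.trans G.bar) ^ j) G.tail

/-- The position of an oriented edge in the boundary cycle, starting at the tail. -/
def position (G : MarkedFatgraph g) (x : G.Dart) : ℕ :=
  sInf {j : ℕ | G.boundaryEdge j = x}

/-- The sum of `F fᵢ₋₁ fᵢ` over the edge-path `x = f₀, f₁, …, fₖ = x̄` of the boundary cycle, for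
`x` preceding `x̄` when the cycle starts at the tail (so that the path does not pass
through the univalent vertex). -/
def pathSum (G : MarkedFatgraph g) (F : G.Dart → G.Dart → Tensors g) (x : G.Dart) : Tensors g :=
  ∑ j ∈ Finset.Ico (G.position x) (G.position (G.bar x)),
    F (G.boundaryEdge j) (G.boundaryEdge (j + 1))

/-- The component `ℓ_n(x)`, of degree `n`, of the logarithm of the fatgraph Magnus expansion:
`ℓ₀ = 0`, `ℓ₁(x)` is the homology class of `x`, and for `n ≥ 2`
`ℓ_n(x) = -(1/3) ∑ᵢ h(ℓ(fᵢ₋₁), -ℓ(fᵢ))_(n)` if the edge-path `(fᵢ)` from `x` to `x̄` along the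
boundary cycle avoids the univalent vertex of the tail, and `ℓ_n(x) = -ℓ_n(x̄)` otherwise.
The degree `n` component of `h` involves only components of `ℓ` of degree `< n`. -/
def ellComp (G : MarkedFatgraph g) (n : ℕ) (x : G.Dart) : Tensors g :=
  if n = 0 then 0
  else if n = 1 then TensorAlgebra.ι ℚ (homologyClass (G.mark x))
  else
    let lower : G.Dart → TensorSeries g := fun f =>
      PowerSeries.mk fun k => if _ : k < n then ellComp G k f else 0
    let S : G.Dart → Tensors g := fun y =>
      (-(1 / 3) : ℚ) • G.pathSum
        (fun f f' => PowerSeries.coeff n (hausdorff (lower f) (-lower f'))) y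
    if G.position x < G.position (G.bar x) then S x else -S (G.bar x)
termination_by n

/-- `ℓ(x) = ∑ₙ ℓ_n(x)`. -/
def ell (G : MarkedFatgraph g) (x : G.Dart) : TensorSeries g :=
  PowerSeries.mk fun n => G.ellComp n x

/-- `θ` is the fatgraph Magnus expansion of `G`: the generalized Magnus expansion with
`θ(x) = exp(ℓ(x))` for (the elements of `π₁` that mark) the oriented edges `x` of `G`. -/
def IsFatgraphMagnus (G : MarkedFatgraph g) (θ : SurfaceGroup g →* TensorSeries g) : Prop :=
  IsMagnusExpansion θ ∧ ∀ x : G.Dart, θ (G.mark x) = expSeries (G.ell x)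

/-- The fatgraph Magnus expansion `θ^G`, that is, the unique `θ` with `IsFatgraphMagnus G θ`. -/
def magnus (G : MarkedFatgraph g) : SurfaceGroup g →* TensorSeries g :=
  Classical.epsilon G.IsFatgraphMagnus

/-- The component `θ^G_n : π₁ → H^{⊗ n}` of degree `n`. -/
def magnusComp (G : MarkedFatgraph g) (n : ℕ) (x : SurfaceGroup g) : Tensors g :=
  PowerSeries.coeff n (G.magnus x)

end MarkedFatgraph

end FatgraphJohnson

end

/-!
For *every* Magnus expansion `θ`, the map `τ_m(φ)` is `[x] ↦ θ_{m+1}(φ x) - θ_{m+1}(x)`, since the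
leading term of `θ` on `Γ_m` is the Magnus map to `𝓛_{m+1}`. The series `ℓ^G` depends only on the
fatgraph and on the homology classes of its marking, which `φ` preserves; hence
`θ^{φ(G)} ∘ φ = θ^G`, and the choice `θ = θ^{φ(G)}` turns the difference above into
`θ^G_{m+1}(x) - θ^{φ(G)}_{m+1}(x)`, the sum of the telescoping series.

That `θ^G` exists means that `e ↦ exp ℓ(e)` respects the relations among the marking elements.
At a trivalent vertex this goes by induction on the degree `n`: the product of the three
exponentials is `1` up to degree `n - 1`, so its degree `n` term is invariant under cyclic rotation,
which makes the three corner terms `h(ℓ(e), ℓ(e'))_(n)` at the vertex equal, and with the factor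
`1/3` this term then vanishes. The vertex and reversal relations suffice because, degree by degree,
the obstruction is a rational 1-cocycle, and by an Euler characteristic count every such cocycle
comes from a character of `π₁`.
-/

noncomputable section

namespace FatgraphJohnson

open PowerSeries

section Truncation

variable {A : Type*} [Ring A] {n p q : ℕ} {f f' h h' : PowerSeries A}

variable (A) in
/-- Congruence modulo `Xⁿ` of power series over a noncommutative ring. -/
def truncCon (n : ℕ) : RingCon (PowerSeries A) where
  r f h := ∀ j < n, coeff j f = coeff j h
  iseqv := ⟨fun _ _ _ => rfl, fun hfh j hj => (hfh j hj).symm,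
    fun h₁ h₂ j hj => (h₁ j hj).trans (h₂ j hj)⟩
  add' h₁ h₂ j hj := by rw [map_add, map_add, h₁ j hj, h₂ j hj]
  mul' h₁ h₂ j hj := by
    rw [coeff_mul, coeff_mul]
    refine Finset.sum_congr rfl fun a ha => ?_
    have ha := Finset.HasAntidiagonal.mem_antidiagonal.1 ha
    rw [h₁ a.1 (by omega), h₂ a.2 (by omega)]

theorem truncCon_iff : truncCon A n f h ↔ ∀ j < n, coeff j f = coeff j h := Iff.rfl

theorem truncCon_succ_iff :
    truncCon A (n + 1) f h ↔ truncCon A n f h ∧ coeff n f = coeff n h := by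
  simp only [truncCon_iff, Nat.forall_lt_succ_right]

theorem truncCon_zero : truncCon A 0 f h := fun _ hj => absurd hj (Nat.not_lt_zero _)

theorem truncCon_one_iff : truncCon A 1 f h ↔ coeff 0 f = coeff 0 h := by
  simp only [truncCon_succ_iff, truncCon_zero, true_and]

theorem eq_of_forall_truncCon (hfh : ∀ n, truncCon A n f h) : f = h :=
  PowerSeries.ext fun n => hfh (n + 1) n n.lt_succ_self

theorem truncCon_sub_zero_iff : truncCon A n (f - h) 0 ↔ truncCon A n f h := by
  simp only [truncCon_iff, map_sub, map_zero, sub_eq_zero]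

theorem truncCon_pow (hfh : truncCon A n f h) (k : ℕ) : truncCon A n (f ^ k) (h ^ k) := by
  induction k with
  | zero => simpa only [pow_zero] using (truncCon A n).refl 1
  | succ k ih => simpa only [pow_succ] using (truncCon A n).mul ih hfh

theorem truncCon_trunc (n : ℕ) (f : PowerSeries A) :
    truncCon A n f (trunc n f : PowerSeries A) := fun j hj => by
  rw [Polynomial.coeff_coe, coeff_trunc, if_pos hj]

theorem coeff_zero_mul (f h : PowerSeries A) : coeff 0 (f * h) = coeff 0 f * coeff 0 h := by
  simp only [coeff_zero_eq_constantCoeff, map_mul]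

theorem truncCon_mul_zero (hf : truncCon A p f 0) (hh : truncCon A q h 0) :
    truncCon A (p + q) (f * h) 0 := by
  intro j hj
  rw [coeff_mul, map_zero]
  refine Finset.sum_eq_zero fun a ha => ?_
  have ha := Finset.HasAntidiagonal.mem_antidiagonal.1 ha
  rcases lt_or_ge a.1 p with h1 | h1
  · rw [hf _ h1, map_zero, zero_mul]
  · rw [hh a.2 (by omega), map_zero, mul_zero]

theorem coeff_add_mul (hf : truncCon A p f 0) (hh : truncCon A q h 0) :
    coeff (p + q) (f * h) = coeff p f * coeff q h := by
  rw [coeff_mul, Finset.sum_eq_single (p, q)]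
  · rintro ⟨a, b⟩ hab hne
    have hab : a + b = p + q := Finset.HasAntidiagonal.mem_antidiagonal.1 hab
    rcases lt_trichotomy a p with h1 | rfl | h1
    · rw [hf _ h1, map_zero, zero_mul]
    · exact absurd (by rw [Nat.add_left_cancel hab]) hne
    · rw [hh b (by omega), map_zero, mul_zero]
  · simp

theorem truncCon_pow_zero (hf : coeff 0 f = 0) (k : ℕ) : truncCon A k (f ^ k) 0 := by
  induction k with
  | zero => exact truncCon_zero
  | succ k ih =>
    rw [pow_succ]
    exact truncCon_mul_zero ih (truncCon_one_iff.2 (by rw [hf, map_zero]))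

theorem coeff_pow_of_lt (hf : coeff 0 f = 0) {k : ℕ} (hk : n < k) : coeff n (f ^ k) = 0 :=
  truncCon_pow_zero hf k n hk

theorem coeff_mul_sub_coeff_mul (hfh : truncCon A n f h) (hfh' : truncCon A n f' h') :
    coeff n (f * f') - coeff n (h * h') =
      (coeff n f - coeff n h) * coeff 0 f' + coeff 0 h * (coeff n f' - coeff n h') := by
  have hl := coeff_add_mul (truncCon_sub_zero_iff.2 hfh) (truncCon_zero (f := f') (h := 0))
  have hr := coeff_add_mul (truncCon_zero (f := h) (h := 0)) (truncCon_sub_zero_iff.2 hfh')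
  rw [add_zero] at hl
  rw [zero_add] at hr
  rw [← map_sub, ← map_sub, ← map_sub, ← hr, ← hl, ← map_add, sub_mul, mul_sub,
    sub_add_sub_cancel]

theorem coeff_mul_sub_coeff_mul_of_coeff_zero (hfh : truncCon A n f h) (hfh' : truncCon A n f' h')
    (hf' : coeff 0 f' = 1) (hh : coeff 0 h = 1) :
    coeff n (f * f') - coeff n (h * h') =
      (coeff n f - coeff n h) + (coeff n f' - coeff n h') := by
  rw [coeff_mul_sub_coeff_mul hfh hfh', hf', hh, mul_one, one_mul]

theorem coeff_pow_sub_coeff_pow (hf : coeff 0 f = 0) (hh : coeff 0 h = 0)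
    (hfh : truncCon A n f h) {k : ℕ} (hk : k ≠ 1) : coeff n (f ^ k) - coeff n (h ^ k) = 0 := by
  match k with
  | 0 => simp only [pow_zero, sub_self]
  | 1 => exact absurd rfl hk
  | k + 2 =>
    rw [pow_succ f, pow_succ h, coeff_mul_sub_coeff_mul (truncCon_pow hfh _) hfh, hf,
      coeff_pow_of_lt hh k.succ_pos, mul_zero, zero_mul, add_zero]

theorem coeff_mul_comm_of_truncCon (hfh : truncCon A n (f * h) 1) (hhf : truncCon A n (h * f) 1)
    (hf : coeff 0 f = 1) : coeff n (f * h) = coeff n (h * f) := by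
  have hl := coeff_mul_sub_coeff_mul hfh ((truncCon A n).refl f)
  have hr := coeff_mul_sub_coeff_mul ((truncCon A n).refl f) hhf
  rw [sub_self, mul_zero, add_zero, hf, mul_one, one_mul] at hl
  rw [sub_self, zero_mul, zero_add, hf, one_mul, mul_one] at hr
  rwa [mul_assoc, hr, sub_left_inj, eq_comm] at hl

end Truncation

section Evaluation

variable {R A : Type*} [CommRing R] [Ring A] [Algebra R A] {n : ℕ} {u v : PowerSeries A}

theorem coeff_aeval (hu : coeff 0 u = 0) (P : Polynomial R) (n : ℕ) :
    coeff n (Polynomial.aeval u P) =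
      ∑ k ∈ Finset.range (n + 1), P.coeff k • coeff n (u ^ k) := by
  rw [Polynomial.aeval_eq_sum_range' (n := max (P.natDegree + 1) (n + 1)) (by simp), map_sum]
  refine (Finset.sum_subset (fun k => ?_) fun k _ hk => ?_).symm
  · simp only [Finset.mem_range]
    omega
  · rw [PowerSeries.coeff_smul, coeff_pow_of_lt hu (by simpa using hk), smul_zero]

theorem truncCon_aeval (hu : coeff 0 u = 0) {P Q : Polynomial R}
    (hPQ : ∀ k < n, P.coeff k = Q.coeff k) :
    truncCon A n (Polynomial.aeval u P) (Polynomial.aeval u Q) := by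
  intro j hj
  rw [coeff_aeval hu, coeff_aeval hu]
  refine Finset.sum_congr rfl fun k hk => ?_
  rw [hPQ k (by have := Finset.mem_range.1 hk; omega)]

/-- The value `∑ₖ pₖ uᵏ` of a power series `p` with scalar coefficients at a noncommutative power
series `u` without constant term (so that `uᵏ` does not contribute to the degrees `n < k`). -/
def evalSeries (u : PowerSeries A) (p : PowerSeries R) : PowerSeries A :=
  PowerSeries.mk fun n => ∑ k ∈ Finset.range (n + 1), coeff k p • coeff n (u ^ k)

theorem truncCon_evalSeries_aeval (hu : coeff 0 u = 0) (p : PowerSeries R) (n : ℕ) :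
    truncCon A n (evalSeries u p) (Polynomial.aeval u (trunc n p)) := by
  intro j hj
  rw [coeff_aeval hu, evalSeries, coeff_mk]
  refine Finset.sum_congr rfl fun k hk => ?_
  rw [coeff_trunc, if_pos (by have := Finset.mem_range.1 hk; omega)]

theorem evalSeries_mul (hu : coeff 0 u = 0) (p q : PowerSeries R) :
    evalSeries u (p * q) = evalSeries u p * evalSeries u q := by
  refine eq_of_forall_truncCon fun n => ?_
  have hpq : truncCon A n (Polynomial.aeval u (trunc n (p * q)))
      (Polynomial.aeval u (trunc n p * trunc n q)) := truncCon_aeval hu fun k hk => by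
    rw [coeff_trunc, if_pos hk, ← Polynomial.coeff_coe, Polynomial.coe_mul,
      coeff_mul_eq_coeff_trunc_mul_trunc p q hk]
  refine (truncCon A n).trans (truncCon_evalSeries_aeval hu _ n) ((truncCon A n).trans hpq ?_)
  rw [map_mul]
  exact (truncCon A n).symm ((truncCon A n).mul (truncCon_evalSeries_aeval hu p n)
    (truncCon_evalSeries_aeval hu q n))

/-- `evalSeries u` as an algebra homomorphism. -/
def evalHom (u : PowerSeries A) (hu : coeff 0 u = 0) : PowerSeries R →ₐ[R] PowerSeries A :=
  AlgHom.ofLinearMap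
    { toFun := evalSeries u
      map_add' := fun p q => by
        ext n
        simp [evalSeries, add_smul, Finset.sum_add_distrib]
      map_smul' := fun c p => by
        ext n
        simp [evalSeries, mul_smul, Finset.smul_sum] }
    (by
      ext n
      simp [evalSeries, PowerSeries.coeff_one])
    (evalSeries_mul hu)

theorem evalHom_apply (hu : coeff 0 u = 0) (p : PowerSeries R) :
    evalHom u hu p = evalSeries u p := rfl

theorem coeff_zero_evalSeries (u : PowerSeries A) (p : PowerSeries R) :
    coeff 0 (evalSeries u p) = algebraMap R A (coeff 0 p) := by
  simp [evalSeries, Algebra.smul_def]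

theorem evalSeries_X (hu : coeff 0 u = 0) : evalSeries u (X : PowerSeries R) = u := by
  ext n
  rcases n with _ | n
  · simp [evalSeries, hu]
  · simp [evalSeries, coeff_X]

theorem truncCon_algHom_apply {F : PowerSeries R →ₐ[R] PowerSeries A} (hF : coeff 0 (F X) = 0)
    (p : PowerSeries R) (n : ℕ) :
    truncCon A n (F p) (Polynomial.aeval (F X) (trunc n p)) := by
  have hpoly : F (trunc n p) = Polynomial.aeval (F X) (trunc n p) := by
    simpa using (Polynomial.aeval_algHom_apply (F.comp (Polynomial.coeToPowerSeries.algHom R))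
      Polynomial.X (trunc n p)).symm
  have hsplit := congrArg F (eq_X_pow_mul_shift_add_trunc n p)
  rw [map_add, map_mul, map_pow, hpoly, ← sub_eq_iff_eq_add] at hsplit
  rw [← truncCon_sub_zero_iff, hsplit]
  exact truncCon_mul_zero (q := 0) (truncCon_pow_zero hF n) truncCon_zero

theorem algHom_apply_eq_evalSeries {F : PowerSeries R →ₐ[R] PowerSeries A}
    (hF : coeff 0 (F X) = 0) (p : PowerSeries R) : F p = evalSeries (F X) p :=
  eq_of_forall_truncCon fun n => (truncCon A n).trans (truncCon_algHom_apply hF p n)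
    ((truncCon A n).symm (truncCon_evalSeries_aeval hF p n))

theorem evalSeries_evalSeries (hu : coeff 0 u = 0) {p : PowerSeries R} (hp : coeff 0 p = 0)
    (q : PowerSeries R) : evalSeries (evalSeries u p) q = evalSeries u (evalSeries p q) := by
  have hX : ((evalHom u hu).comp (evalHom p hp)) X = evalSeries u p := by
    simp only [AlgHom.comp_apply, evalHom_apply, evalSeries_X hp]
  have h0 : coeff 0 (((evalHom u hu).comp (evalHom p hp)) X) = 0 := by
    rw [hX, coeff_zero_evalSeries, hp, map_zero]
  rw [← hX, ← algHom_apply_eq_evalSeries h0, AlgHom.comp_apply, evalHom_apply, evalHom_apply]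

theorem evalSeries_eq_subst {p : PowerSeries R} (hp : coeff 0 p = 0) (q : PowerSeries R) :
    evalSeries p q = q.subst p := by
  have hs : HasSubst p := HasSubst.of_constantCoeff_zero' (by simpa using hp)
  have hX : substAlgHom hs (X : PowerSeries R) = p := substAlgHom_X hs
  rw [← coe_substAlgHom hs, algHom_apply_eq_evalSeries (by rw [hX, hp]), hX]

theorem truncCon_evalSeries (huv : truncCon A n u v) (p : PowerSeries R) :
    truncCon A n (evalSeries u p) (evalSeries v p) := by
  intro j hj
  simp only [evalSeries, coeff_mk]
  exact Finset.sum_congr rfl fun k _ => by rw [truncCon_pow huv k j hj]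

theorem coeff_evalSeries_sub (hu : coeff 0 u = 0) (hv : coeff 0 v = 0) (huv : truncCon A n u v)
    (p : PowerSeries R) : coeff n (evalSeries u p) - coeff n (evalSeries v p) =
      coeff 1 p • (coeff n u - coeff n v) := by
  simp only [evalSeries, coeff_mk, ← Finset.sum_sub_distrib, ← smul_sub]
  rw [Finset.sum_eq_single 1, pow_one, pow_one]
  · intro k _ hk
    rw [coeff_pow_sub_coeff_pow hu hv huv hk, smul_zero]
  · intro hn
    obtain rfl : n = 0 := by simpa using hn
    rw [pow_one, pow_one, hu, hv, sub_self, smul_zero]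

end Evaluation

section ExpLog

theorem exp_subst_log : (exp ℚ).subst (log ℚ) = 1 + X := by
  set F := (exp ℚ).subst (log ℚ) with hF
  set L := derivative ℚ (log ℚ) with hL
  have hgeom : L * (1 + X) = 1 := by
    rw [hL, deriv_log]
    ext n
    rcases n with _ | n
    · simp [mul_add]
    · simp [mul_add, coeff_succ_mul_X, PowerSeries.coeff_one, pow_succ]
  have hdF : derivative ℚ F = F * L := by
    rw [hF, derivative_subst HasSubst.log, derivative_exp]
  have hdL : derivative ℚ L = -(L * L) := by
    have h := congrArg (derivative ℚ) hgeom
    simp only [Derivation.leibniz, smul_eq_mul, map_add, Derivation.map_one_eq_zero, zero_add,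
      derivative_X, mul_one] at h
    linear_combination L * h - derivative ℚ L * hgeom
  have hFL : F * L = 1 := by
    refine derivative.ext ?_ ?_
    · simp only [Derivation.leibniz, smul_eq_mul, hdF, hdL, Derivation.map_one_eq_zero]
      ring
    · rw [map_mul, map_one, hF, ← evalSeries_eq_subst (by simp),
        ← coeff_zero_eq_constantCoeff_apply, coeff_zero_evalSeries, hL, deriv_log]
      simp
  linear_combination (1 + X) * hFL - F * hgeom

variable {A : Type*} [Ring A] [Algebra ℚ A] {n : ℕ} {f h : PowerSeries A}

theorem expSeries_eq_evalSeries (f : PowerSeries A) : expSeries f = evalSeries f (exp ℚ) := by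
  ext n
  simp [expSeries, evalSeries, coeff_exp]

theorem logSeries_eq_evalSeries (f : PowerSeries A) :
    logSeries f = evalSeries (f - 1) (log ℚ) := by
  ext n
  have hr : Finset.Icc 1 n ⊆ Finset.range (n + 1) := fun k hk => by
    simp only [Finset.mem_Icc, Finset.mem_range] at *
    omega
  simp only [logSeries, evalSeries, coeff_mk]
  refine (Finset.sum_congr rfl fun k hk => ?_).trans (Finset.sum_subset hr fun k _ hk => ?_)
  · have := (Finset.mem_Icc.1 hk).1
    rw [coeff_log, if_neg (by omega), Algebra.algebraMap_self_apply]
  · obtain rfl : k = 0 := by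
      simp only [Finset.mem_range, Finset.mem_Icc] at *
      omega
    rw [coeff_log, if_pos rfl, zero_smul]

theorem coeff_zero_expSeries (f : PowerSeries A) : coeff 0 (expSeries f) = 1 := by
  simp [expSeries]

theorem coeff_zero_logSeries (f : PowerSeries A) : coeff 0 (logSeries f) = 0 := by
  simp [logSeries]

omit [Algebra ℚ A] in
theorem coeff_zero_sub_one (hf : coeff 0 f = 1) : coeff 0 (f - 1) = 0 := by
  rw [map_sub, hf, coeff_zero_one, sub_self]

theorem coeff_zero_expSeries_mul (f h : PowerSeries A) :
    coeff 0 (expSeries f * expSeries h) = 1 := by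
  rw [coeff_zero_mul, coeff_zero_expSeries, coeff_zero_expSeries, mul_one]

theorem coeff_one_expSeries (f : PowerSeries A) : coeff 1 (expSeries f) = coeff 1 f := by
  simp [expSeries, Finset.sum_range_succ, PowerSeries.coeff_one]

theorem expSeries_logSeries (hf : coeff 0 f = 1) : expSeries (logSeries f) = f := by
  have hf' := coeff_zero_sub_one hf
  rw [expSeries_eq_evalSeries, logSeries_eq_evalSeries, evalSeries_evalSeries hf' (by simp),
    evalSeries_eq_subst (by simp), exp_subst_log, ← evalHom_apply hf', map_add, map_one,
    evalHom_apply, evalSeries_X hf', add_sub_cancel]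

theorem expSeries_neg_mul (hf : coeff 0 f = 0) : expSeries (-f) * expSeries f = 1 := by
  have hX : evalSeries (-X) (exp ℚ) = evalNegHom (exp ℚ) := by
    rw [evalSeries_eq_subst (by simp), evalNegHom, rescale_eq_subst, neg_one_smul]
  have hneg : expSeries (-f) = evalSeries f (evalNegHom (exp ℚ)) := by
    rw [← hX, ← evalSeries_evalSeries hf (by simp), ← evalHom_apply hf (-X), map_neg,
      evalHom_apply, evalSeries_X hf, expSeries_eq_evalSeries]
  rw [hneg, expSeries_eq_evalSeries, ← evalSeries_mul hf, mul_comm, exp_mul_exp_neg_eq_one,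
    ← evalHom_apply hf, map_one]

theorem truncCon_expSeries (hfh : truncCon A n f h) :
    truncCon A n (expSeries f) (expSeries h) := by
  simpa only [expSeries_eq_evalSeries] using truncCon_evalSeries hfh (exp ℚ)

theorem coeff_expSeries_sub (hf : coeff 0 f = 0) (hh : coeff 0 h = 0) (hfh : truncCon A n f h) :
    coeff n (expSeries f) - coeff n (expSeries h) = coeff n f - coeff n h := by
  rw [expSeries_eq_evalSeries, expSeries_eq_evalSeries, coeff_evalSeries_sub hf hh hfh,
    coeff_exp]
  simp

theorem truncCon_of_expSeries (hf : coeff 0 f = 0) (hh : coeff 0 h = 0)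
    (hfh : truncCon A n (expSeries f) (expSeries h)) : truncCon A n f h := by
  induction n with
  | zero => exact truncCon_zero
  | succ n ih =>
    rw [truncCon_succ_iff] at hfh ⊢
    refine ⟨ih hfh.1, sub_eq_zero.1 ?_⟩
    rw [← coeff_expSeries_sub hf hh (ih hfh.1), hfh.2, sub_self]

end ExpLog

section Hausdorff

variable {A : Type*} [Ring A] [Algebra ℚ A] {n : ℕ} {X X' Y Y' Z : PowerSeries A}

theorem expSeries_add_add_hausdorff (X Y : PowerSeries A) :
    expSeries (X + Y + hausdorff X Y) = expSeries X * expSeries Y := by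
  rw [hausdorff, sub_sub, add_sub_cancel, expSeries_logSeries (coeff_zero_expSeries_mul X Y)]

theorem coeff_zero_add_add_hausdorff (X Y : PowerSeries A) :
    coeff 0 (X + Y + hausdorff X Y) = 0 := by
  rw [hausdorff, sub_sub, add_sub_cancel, coeff_zero_logSeries]

theorem coeff_one_hausdorff (X Y : PowerSeries A) : coeff 1 (hausdorff X Y) = 0 := by
  have h := congrArg (coeff 1) (expSeries_add_add_hausdorff X Y)
  rw [coeff_one_expSeries, coeff_mul] at h
  simpa [coeff_one_expSeries, coeff_zero_expSeries, Finset.Nat.antidiagonal_succ,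
    add_comm (coeff 1 Y)] using h

theorem coeff_hausdorff_congr (hX : coeff 0 X = 0) (hX' : coeff 0 X' = 0) (hY : coeff 0 Y = 0)
    (hY' : coeff 0 Y' = 0) (hXX' : truncCon A n X X') (hYY' : truncCon A n Y Y') :
    coeff n (hausdorff X Y) = coeff n (hausdorff X' Y') := by
  have hS := coeff_zero_add_add_hausdorff X Y
  have hS' := coeff_zero_add_add_hausdorff X' Y'
  have hmul := (truncCon A n).mul (truncCon_expSeries hXX') (truncCon_expSeries hYY')
  have hdiff := coeff_expSeries_sub hS hS' (truncCon_of_expSeries hS hS' (by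
    rwa [expSeries_add_add_hausdorff, expSeries_add_add_hausdorff]))
  rw [expSeries_add_add_hausdorff, expSeries_add_add_hausdorff,
    coeff_mul_sub_coeff_mul_of_coeff_zero (truncCon_expSeries hXX') (truncCon_expSeries hYY')
      (coeff_zero_expSeries _) (coeff_zero_expSeries _),
    coeff_expSeries_sub hX hX' hXX', coeff_expSeries_sub hY hY' hYY'] at hdiff
  rw [map_add, map_add, map_add, map_add, add_sub_add_comm, add_sub_add_comm] at hdiff
  exact sub_eq_zero.1 (left_eq_add.1 hdiff)

/-- Both the product and `exp (-Z) * exp Z = 1` have factors agreeing modulo `Xⁿ`, since the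
hypothesis makes `-Z` agree with the logarithm of `exp X * exp Y`. -/
theorem coeff_expSeries_mul_mul (hZ : coeff 0 Z = 0) (hn : n ≠ 0)
    (h : truncCon A n (expSeries X * expSeries Y * expSeries Z) 1) :
    coeff n (expSeries X * expSeries Y * expSeries Z) =
      coeff n X + coeff n Y + coeff n Z + coeff n (hausdorff X Y) := by
  have hS := coeff_zero_add_add_hausdorff X Y
  have hZ' : coeff 0 (-Z) = 0 := by rw [map_neg, hZ, neg_zero]
  have hinv : expSeries Z * expSeries (-Z) = 1 := by
    simpa only [neg_neg] using expSeries_neg_mul hZ'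
  have hneg : truncCon A n (expSeries X * expSeries Y) (expSeries (-Z)) := by
    have := (truncCon A n).mul h ((truncCon A n).refl (expSeries (-Z)))
    rwa [mul_assoc, hinv, mul_one, one_mul] at this
  have hSZ := coeff_expSeries_sub hS hZ' (truncCon_of_expSeries hS hZ' (by
    rwa [expSeries_add_add_hausdorff]))
  have hmul := coeff_mul_sub_coeff_mul_of_coeff_zero hneg ((truncCon A n).refl (expSeries Z))
    (coeff_zero_expSeries _) (coeff_zero_expSeries _)
  rw [expSeries_neg_mul hZ, PowerSeries.coeff_one, if_neg hn, sub_zero, sub_self, add_zero,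
    ← expSeries_add_add_hausdorff, hSZ] at hmul
  rw [← expSeries_add_add_hausdorff, hmul]
  simp only [map_add, map_neg]
  abel

end Hausdorff

section UnipotentHom

variable {Γ A : Type*} [Group Γ] [Ring A] {θ : Γ →* PowerSeries A} {n p q : ℕ} {x y : Γ}

theorem truncCon_map_of_mul_inv (h : truncCon A n (θ (x * y⁻¹)) 1) :
    truncCon A n (θ x) (θ y) := by
  have hmul := (truncCon A n).mul h ((truncCon A n).refl (θ y))
  rwa [← map_mul, inv_mul_cancel_right, one_mul] at hmul

theorem truncCon_map_inv (h : truncCon A n (θ x) 1) : truncCon A n (θ x⁻¹) 1 := by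
  have hmul := (truncCon A n).mul ((truncCon A n).refl (θ x⁻¹)) h
  rw [← map_mul, inv_mul_cancel, map_one, mul_one] at hmul
  exact (truncCon A n).symm hmul

theorem map_commutator_sub_one (θ : Γ →* PowerSeries A) (x y : Γ) :
    θ ⁅x, y⁆ - 1 =
      ((θ x - 1) * (θ y - 1) - (θ y - 1) * (θ x - 1)) * θ (x⁻¹ * y⁻¹) := by
  have hcomm : (θ x - 1) * (θ y - 1) - (θ y - 1) * (θ x - 1) = θ (x * y) - θ (y * x) := by
    rw [map_mul, map_mul]
    noncomm_ring
  rw [hcomm, sub_mul, ← map_mul, ← map_mul, commutatorElement_def,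
    show y * x * (x⁻¹ * y⁻¹) = 1 by group, map_one, ← mul_assoc]

theorem truncCon_bracket_zero {f h : PowerSeries A} (hf : truncCon A p f 0)
    (hh : truncCon A q h 0) : truncCon A (p + q) (f * h - h * f) 0 := by
  refine truncCon_sub_zero_iff.2 ((truncCon A _).trans (truncCon_mul_zero hf hh) ?_)
  exact (truncCon A _).symm (add_comm q p ▸ truncCon_mul_zero hh hf)

theorem truncCon_map_commutator (hx : truncCon A p (θ x) 1) (hy : truncCon A q (θ y) 1) :
    truncCon A (p + q) (θ ⁅x, y⁆) 1 := by
  rw [← truncCon_sub_zero_iff] at hx hy ⊢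
  rw [map_commutator_sub_one]
  exact truncCon_mul_zero (q := 0) (truncCon_bracket_zero hx hy) truncCon_zero

theorem coeff_sub_one (f : PowerSeries A) (hn : n ≠ 0) : coeff n (f - 1) = coeff n f := by
  rw [map_sub, PowerSeries.coeff_one, if_neg hn, sub_zero]

variable (hθ : ∀ x, coeff 0 (θ x) = 1)
include hθ

theorem coeff_map_commutator (hp : p ≠ 0) (hq : q ≠ 0) (hx : truncCon A p (θ x) 1)
    (hy : truncCon A q (θ y) 1) :
    coeff (p + q) (θ ⁅x, y⁆) = ⁅coeff p (θ x), coeff q (θ y)⁆ := by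
  rw [← truncCon_sub_zero_iff] at hx hy
  have hlead := coeff_add_mul (truncCon_bracket_zero hx hy)
    (truncCon_zero (f := θ (x⁻¹ * y⁻¹)) (h := 0))
  have hyx := coeff_add_mul hy hx
  rw [add_comm q p] at hyx
  rw [← coeff_sub_one _ (by omega), map_commutator_sub_one, ← add_zero (p + q), hlead, hθ,
    mul_one, map_sub, coeff_add_mul hx hy, hyx, coeff_sub_one _ hp, coeff_sub_one _ hq,
    Ring.lie_def]

theorem coeff_map_mul (hn : n ≠ 0) (hx : truncCon A n (θ x) 1) (hy : truncCon A n (θ y) 1) :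
    coeff n (θ (x * y)) = coeff n (θ x) + coeff n (θ y) := by
  have h := coeff_mul_sub_coeff_mul_of_coeff_zero hx hy (hθ y) coeff_zero_one
  simpa only [← map_mul, ← map_sub, mul_one, coeff_sub_one _ hn] using h

theorem coeff_map_sub_of_mul_inv (hn : n ≠ 0) (h : truncCon A n (θ (x * y⁻¹)) 1) :
    coeff n (θ x) - coeff n (θ y) = coeff n (θ (x * y⁻¹)) := by
  have hmul := coeff_mul_sub_coeff_mul_of_coeff_zero h ((truncCon A n).refl (θ y)) (hθ y)
    coeff_zero_one
  rwa [← map_mul, inv_mul_cancel_right, one_mul, sub_self, add_zero, ← map_sub _ _ 1,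
    coeff_sub_one _ hn] at hmul

theorem coeff_map_inv (hn : n ≠ 0) (h : truncCon A n (θ x) 1) :
    coeff n (θ x⁻¹) = -coeff n (θ x) := by
  have hinv := coeff_map_mul hθ hn (truncCon_map_inv h) h
  rw [inv_mul_cancel, map_one, PowerSeries.coeff_one, if_neg hn] at hinv
  exact eq_neg_of_add_eq_zero_left hinv.symm

end UnipotentHom

section Descent

variable {F P A : Type*} [Group F] [Group P] [Ring A] {q : F →* P} {T : F →* PowerSeries A}

/-- The two sides agree modulo `Xⁿ` by induction on `n`: if they do, then the difference of their
coefficients of degree `n` is an additive character that vanishes on the relators and on the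
section. -/
theorem map_section_of_relators {s : P →* F} (hs : ∀ p, q (s p) = p) {R : Set F}
    (hqR : ∀ r ∈ R, q r = 1)
    (hR : ∀ δ : F →* Multiplicative A, (∀ r ∈ R, δ r = 1) → q.ker ≤ δ.ker)
    (hT : ∀ w, coeff 0 (T w) = 1) (hTR : ∀ r ∈ R, T r = 1) (w : F) :
    T (s (q w)) = T w := by
  refine eq_of_forall_truncCon fun n => ?_
  induction n generalizing w with
  | zero => exact truncCon_zero
  | succ n ih =>
    let δ : F →* Multiplicative A := MonoidHom.mk'
      (fun w => .ofAdd (coeff n (T (s (q w))) - coeff n (T w))) fun x y => by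
        rw [← ofAdd_add, ← coeff_mul_sub_coeff_mul_of_coeff_zero (ih x) (ih y) (hT _) (hT _)]
        simp only [map_mul]
    have hδ (w) : δ w = 1 ↔ coeff n (T (s (q w))) = coeff n (T w) := sub_eq_zero (G := A)
    have hδR (r) (hr : r ∈ R) : δ r = 1 := by
      rw [hδ, hqR r hr, hTR r hr, map_one, map_one]
    have hker : w⁻¹ * s (q w) ∈ q.ker := by
      rw [MonoidHom.mem_ker, map_mul, map_inv, hs, inv_mul_cancel]
    have hδw : δ w = δ (s (q w)) := by
      rw [← inv_mul_eq_one, ← map_inv, ← map_mul]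
      exact hR δ hδR hker
    rw [truncCon_succ_iff]
    exact ⟨ih w, (hδ w).1 (hδw.trans ((hδ _).2 (by rw [hs])))⟩

end Descent

variable {g : ℕ}

section Homology

theorem homologyClass_mul (x y : SurfaceGroup g) :
    homologyClass (x * y) = homologyClass x + homologyClass y := by
  simp [homologyClass, TensorProduct.tmul_add]

theorem homologyClass_one : homologyClass (1 : SurfaceGroup g) = 0 := by
  simp [homologyClass]

theorem homologyClass_inv (x : SurfaceGroup g) : homologyClass x⁻¹ = -homologyClass x := by
  rw [eq_neg_iff_add_eq_zero, ← homologyClass_mul, inv_mul_cancel, homologyClass_one]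

variable {V : Type*} [AddCommGroup V] [Module ℚ V]

theorem homology_hom_ext {τ τ' : Homology g →ₗ[ℚ] V}
    (h : ∀ x : SurfaceGroup g, τ (homologyClass x) = τ' (homologyClass x)) : τ = τ' := by
  refine LinearMap.ext fun z => ?_
  induction z using TensorProduct.induction_on with
  | zero => rw [map_zero, map_zero]
  | add a b ha hb => rw [map_add, map_add, ha, hb]
  | tmul q a =>
    obtain ⟨x, hx⟩ := QuotientGroup.mk_surjective a.toMul
    have hclass : q ⊗ₜ[ℤ] a = q • homologyClass x := by
      have hx' : Additive.ofMul (Abelianization.of x) = a := hx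
      rw [homologyClass, TensorProduct.smul_tmul', smul_eq_mul, mul_one, hx']
    rw [hclass, map_smul, map_smul, h]

theorem exists_homology_lift (D : SurfaceGroup g →* Multiplicative V) :
    ∃ τ : Homology g →ₗ[ℚ] V, ∀ x, τ (homologyClass x) = (D x).toAdd := by
  let L : Additive (Abelianization (SurfaceGroup g)) →+ V :=
    MonoidHom.toAdditiveLeft (Abelianization.lift D)
  refine ⟨LinearMap.liftBaseChange ℚ L.toIntLinearMap, fun x => ?_⟩
  rw [homologyClass, LinearMap.liftBaseChange_tmul, one_smul]
  simp [L]

end Homology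

section Homogeneous

/-- The component `H^{⊗ n}` of the tensor algebra, as it appears in `IsHomogeneous`. -/
abbrev tensorDegree (g n : ℕ) : Submodule ℚ (Tensors g) :=
  (LinearMap.range (TensorAlgebra.ι ℚ (M := Homology g)) : Submodule ℚ (Tensors g)) ^ n

variable {n : ℕ} {f h : TensorSeries g}

theorem IsHomogeneous.one : IsHomogeneous (1 : TensorSeries g) := by
  intro n
  rw [PowerSeries.coeff_one]
  split_ifs with hn
  · rw [hn, pow_zero]
    exact Submodule.one_le.1 le_rfl
  · exact zero_mem _

theorem IsHomogeneous.sub (hf : IsHomogeneous f) (hh : IsHomogeneous h) :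
    IsHomogeneous (f - h) := fun n => by
  rw [map_sub]
  exact sub_mem (hf n) (hh n)

theorem IsHomogeneous.mul (hf : IsHomogeneous f) (hh : IsHomogeneous h) :
    IsHomogeneous (f * h) := fun n => by
  rw [PowerSeries.coeff_mul]
  refine sum_mem fun a ha => ?_
  rw [← Finset.HasAntidiagonal.mem_antidiagonal.1 ha, pow_add]
  exact Submodule.mul_mem_mul (hf _) (hh _)

theorem IsHomogeneous.pow (hf : IsHomogeneous f) (k : ℕ) : IsHomogeneous (f ^ k) := by
  induction k with
  | zero => rw [pow_zero]; exact .one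
  | succ k ih => rw [pow_succ]; exact ih.mul hf

theorem IsHomogeneous.expSeries (hf : IsHomogeneous f) : IsHomogeneous (expSeries f) :=
  fun n => by
    rw [FatgraphJohnson.expSeries, coeff_mk]
    exact sum_mem fun k _ => Submodule.smul_mem _ _ (hf.pow k n)

theorem IsHomogeneous.logSeries (hf : IsHomogeneous f) : IsHomogeneous (logSeries f) :=
  fun n => by
    rw [FatgraphJohnson.logSeries, coeff_mk]
    exact sum_mem fun k _ => Submodule.smul_mem _ _ ((hf.sub .one).pow k n)

theorem IsHomogeneous.hausdorff (hf : IsHomogeneous f) (hh : IsHomogeneous h) :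
    IsHomogeneous (hausdorff f h) :=
  ((hf.expSeries.mul hh.expSeries).logSeries.sub hf).sub hh

theorem isHomogeneous_trunc (hf : ∀ k < n, coeff k f ∈ tensorDegree g k) :
    IsHomogeneous (trunc n f : TensorSeries g) := fun k => by
  rw [Polynomial.coeff_coe, coeff_trunc]
  split_ifs with hk
  exacts [hf k hk, zero_mem _]

theorem coeff_hausdorff_mem (hf0 : coeff 0 f = 0) (hh0 : coeff 0 h = 0)
    (hf : ∀ k < n, coeff k f ∈ tensorDegree g k) (hh : ∀ k < n, coeff k h ∈ tensorDegree g k) :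
    coeff n (hausdorff f h) ∈ tensorDegree g n := by
  have hzero {f : TensorSeries g} (hf0 : coeff 0 f = 0) :
      coeff 0 (trunc n f : TensorSeries g) = 0 := by
    rw [Polynomial.coeff_coe, coeff_trunc, hf0, ite_self]
  rw [coeff_hausdorff_congr hf0 (hzero hf0) hh0 (hzero hh0) (truncCon_trunc n f)
    (truncCon_trunc n h)]
  exact (isHomogeneous_trunc hf).hausdorff (isHomogeneous_trunc hh) n

end Homogeneous

section Johnson

variable {θ : SurfaceGroup g →* TensorSeries g} {k m : ℕ} {x y : SurfaceGroup g} {u : Tensors g}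
  {φ : mappingClassGroup g}

theorem IsLieClass.truncCon_and_coeff (hθ : IsMagnusExpansion θ) (h : IsLieClass k x u) :
    truncCon _ (k + 1) (θ x) 1 ∧ coeff (k + 1) (θ x) = u := by
  have hθ₁ (x) : truncCon _ 1 (θ x) 1 :=
    truncCon_one_iff.2 (by rw [hθ.coeff_zero, coeff_zero_one])
  induction h with
  | of x => exact ⟨hθ₁ x, hθ.coeff_one x⟩
  | @commutator k x u y _ ih =>
    refine ⟨truncCon_map_commutator ih.1 (hθ₁ y), ?_⟩
    rw [coeff_map_commutator hθ.coeff_zero k.succ_ne_zero one_ne_zero ih.1 (hθ₁ y), ih.2,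
      hθ.coeff_one]
  | @mul k x y u v _ _ ihx ihy =>
    refine ⟨by simpa only [map_mul, mul_one] using (truncCon _ _).mul ihx.1 ihy.1, ?_⟩
    rw [coeff_map_mul hθ.coeff_zero k.succ_ne_zero ihx.1 ihy.1, ihx.2, ihy.2]
  | @inv k x u _ ih =>
    refine ⟨truncCon_map_inv ih.1, ?_⟩
    rw [coeff_map_inv hθ.coeff_zero k.succ_ne_zero ih.1, ih.2]

theorem IsLieClass.coeff_sub (hθ : IsMagnusExpansion θ) (h : IsLieClass k (x * y⁻¹) u) :
    coeff (k + 1) (θ x) - coeff (k + 1) (θ y) = u := by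
  obtain ⟨hone, hu⟩ := h.truncCon_and_coeff hθ
  rw [coeff_map_sub_of_mul_inv hθ.coeff_zero k.succ_ne_zero hone, hu]

theorem exists_isLieClass (hx : x ∈ (⊤ : Subgroup (SurfaceGroup g)).lowerCentralSeries k) :
    ∃ u, IsLieClass k x u := by
  induction k generalizing x with
  | zero => exact ⟨_, .of x⟩
  | succ k ih =>
    rw [Subgroup.mem_lowerCentralSeries_succ_iff] at hx
    induction hx using Subgroup.closure_induction with
    | mem x hx =>
      obtain ⟨p, hp, q, _, rfl⟩ := hx
      obtain ⟨u, hu⟩ := ih hp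
      exact ⟨_, .commutator q hu⟩
    | one =>
      obtain ⟨u, hu⟩ := ih (one_mem _)
      exact ⟨_, by simpa using IsLieClass.commutator 1 hu⟩
    | mul x y _ _ hx hy =>
      obtain ⟨u, hu⟩ := hx
      obtain ⟨v, hv⟩ := hy
      exact ⟨_, .mul hu hv⟩
    | inv x _ hx =>
      obtain ⟨u, hu⟩ := hx
      exact ⟨_, .inv hu⟩

theorem mul_inv_mem_of_mem_torelli (hφ : φ ∈ torelli g m) (x : SurfaceGroup g) :
    φ.1 x * x⁻¹ ∈ (⊤ : Subgroup (SurfaceGroup g)).lowerCentralSeries m :=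
  Subgroup.Normal.mem_comm inferInstance (QuotientGroup.eq.1 (hφ x).symm)

theorem homologyClass_of_mem_torelli (hm : 1 ≤ m) (hφ : φ ∈ torelli g m) (x : SurfaceGroup g) :
    homologyClass (φ.1 x) = homologyClass x := by
  have hcomm := Subgroup.lowerCentralSeries_antitone _ hm (mul_inv_mem_of_mem_torelli hφ x)
  rw [Subgroup.top_lowerCentralSeries_one] at hcomm
  have hof : Abelianization.of (φ.1 x * x⁻¹) = 1 := (QuotientGroup.eq_one_iff _).2 hcomm
  rw [map_mul, map_inv, mul_inv_eq_one] at hof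
  rw [homologyClass, homologyClass, hof]

theorem IsJohnson.apply_homologyClass (hθ : IsMagnusExpansion θ)
    {τ : Homology g →ₗ[ℚ] Tensors g} (hτ : IsJohnson m φ τ) (x : SurfaceGroup g) :
    τ (homologyClass x) = coeff (m + 1) (θ (φ.1 x)) - coeff (m + 1) (θ x) :=
  ((hτ x).coeff_sub hθ).symm

theorem existsUnique_isJohnson (hθ : IsMagnusExpansion θ) (hφ : φ ∈ torelli g m) :
    ∃! τ : Homology g →ₗ[ℚ] Tensors g, IsJohnson m φ τ := by
  choose u hu using fun x => exists_isLieClass (mul_inv_mem_of_mem_torelli hφ x)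
  have htrunc (x) : truncCon _ (m + 1) (θ (φ.1 x)) (θ x) :=
    truncCon_map_of_mul_inv ((hu x).truncCon_and_coeff hθ).1
  have hmul (x y) : u (x * y) = u x + u y := by
    simp only [← (hu _).coeff_sub hθ, map_mul]
    exact coeff_mul_sub_coeff_mul_of_coeff_zero (htrunc x) (htrunc y) (hθ.coeff_zero _)
      (hθ.coeff_zero _)
  obtain ⟨τ, hτ⟩ := exists_homology_lift
    (MonoidHom.mk' (fun x => Multiplicative.ofAdd (u x)) fun x y => by rw [hmul, ofAdd_add])
  refine ⟨τ, fun x => ?_, fun τ' hτ' => homology_hom_ext fun x => ?_⟩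
  · exact (hτ x).symm ▸ hu x
  · rw [hτ, hτ'.apply_homologyClass hθ, (hu x).coeff_sub hθ]
    rfl

theorem isJohnson_johnson (h : ∃ τ : Homology g →ₗ[ℚ] Tensors g, IsJohnson m φ τ) :
    IsJohnson m φ (johnson m φ) :=
  Classical.epsilon_spec h

end Johnson

section Invariants

variable {D : Type*} {σ : Equiv.Perm D}

/-- The functions on `D` that are invariant under the permutation `σ`, that is, the functions on
the set of its cycles. -/
def invariants (K : Type*) [Field K] (σ : Equiv.Perm D) : Submodule K (D → K) where
  carrier := {β | β ∘ σ = β}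
  add_mem' := fun {a b} (ha : a ∘ σ = a) (hb : b ∘ σ = b) => congrArg₂ (· + ·) ha hb
  zero_mem' := rfl
  smul_mem' := fun c a (ha : a ∘ σ = a) => congrArg (c • ·) ha

theorem finrank_invariants [Finite D] (K : Type*) [Field K] (σ : Equiv.Perm D) :
    Module.finrank K (invariants K σ) =
      Nat.card (Quotient (Equiv.Perm.SameCycle.setoid σ)) := by
  have := Fintype.ofFinite (Quotient (Equiv.Perm.SameCycle.setoid σ))
  have hrange : LinearMap.range (LinearMap.funLeft K K
      (Quotient.mk (Equiv.Perm.SameCycle.setoid σ))) = invariants K σ := by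
    ext β
    constructor
    · rintro ⟨b, rfl⟩
      funext x
      exact congrArg b (Quotient.sound (Equiv.Perm.sameCycle_apply_left.2 (.refl σ x)))
    · intro hβ
      refine ⟨Quotient.lift β fun x y hxy => ?_, rfl⟩
      obtain ⟨n, -, rfl⟩ := hxy.exists_pow_eq'
      clear hxy
      induction n with
      | zero => rfl
      | succ n ih => rw [ih, pow_succ', Equiv.Perm.mul_apply, show β (σ _) = β _ from congrFun hβ _]
  rw [← hrange, LinearMap.finrank_range_of_inj
    (LinearMap.funLeft_injective_of_surjective K K _ Quotient.mk_surjective),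
    Module.finrank_fintype_fun_eq_card, Nat.card_eq_fintype_card]

theorem sameCycle_iff_of_involutive (hσ : Function.Involutive σ) {x y : D} :
    σ.SameCycle x y ↔ y = x ∨ y = σ x := by
  constructor
  · rintro ⟨n, rfl⟩
    have hsq : σ ^ (2 : ℤ) = 1 := Equiv.ext fun x => hσ x
    rcases Int.even_or_odd' n with ⟨k, rfl | rfl⟩
    · left
      rw [zpow_mul, hsq, one_zpow, Equiv.Perm.one_apply]
    · right
      rw [zpow_add, zpow_mul, hsq, one_zpow, one_mul, zpow_one]
  · rintro (rfl | rfl)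
    exacts [.refl _ _, Equiv.Perm.sameCycle_apply_right.2 (.refl _ _)]

theorem card_eq_two_mul_card_quotient [Finite D] (hσ : Function.Involutive σ) (hne : ∀ x, σ x ≠ x) :
    Nat.card D = 2 * Nat.card (Quotient (Equiv.Perm.SameCycle.setoid σ)) := by
  classical
  have := Fintype.ofFinite D
  have := Fintype.ofFinite (Quotient (Equiv.Perm.SameCycle.setoid σ))
  have hfiber (y : D) : Finset.univ.filter (fun x =>
      Quotient.mk (Equiv.Perm.SameCycle.setoid σ) x = Quotient.mk _ y) = {y, σ y} := by
    ext x
    rw [Finset.mem_filter_univ, Finset.mem_insert, Finset.mem_singleton, eq_comm, Quotient.eq]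
    exact sameCycle_iff_of_involutive hσ
  rw [Nat.card_eq_fintype_card, Nat.card_eq_fintype_card, ← Finset.card_univ,
    Finset.card_eq_sum_card_fiberwise (f := Quotient.mk (Equiv.Perm.SameCycle.setoid σ))
      (t := Finset.univ) (fun _ _ => Finset.mem_coe.2 (Finset.mem_univ _)),
    Finset.sum_const_nat (m := 2), Finset.card_univ, mul_comm]
  intro q _
  obtain ⟨y, rfl⟩ := Quotient.mk_surjective q
  rw [hfiber, Finset.card_pair (hne y).symm]

end Invariants

namespace MarkedFatgraph

variable (G : MarkedFatgraph g) {n : ℕ} {e : G.Dart}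

section Boundary

theorem rot_bar_tail : G.rot (G.bar G.tail) = G.bar G.tail :=
  (G.univalent_iff _).2 rfl

variable {G} in
theorem rot_ne_bar_tail (he : e ≠ G.bar G.tail) : G.rot e ≠ G.bar G.tail :=
  fun h => he (G.rot.injective (h.trans G.rot_bar_tail.symm))

theorem boundaryEdge_succ (j : ℕ) :
    G.boundaryEdge (j + 1) = G.bar (G.rot (G.boundaryEdge j)) := by
  rw [boundaryEdge, pow_succ']
  rfl

theorem boundaryEdge_position (x : G.Dart) : G.boundaryEdge (G.position x) = x :=
  Nat.sInf_mem (s := {j : ℕ | G.boundaryEdge j = x}) (G.one_boundary x)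

theorem position_boundaryEdge_le (j : ℕ) : G.position (G.boundaryEdge j) ≤ j :=
  Nat.sInf_le rfl

theorem position_bar_ne (x : G.Dart) : G.position (G.bar x) ≠ G.position x := fun h =>
  G.bar_ne x (by rw [← G.boundaryEdge_position (G.bar x), h, G.boundaryEdge_position])

variable {G} in
theorem position_bar_rot (he : e ≠ G.bar G.tail) :
    G.position (G.bar (G.rot e)) = G.position e + 1 := by
  have hnext : G.boundaryEdge (G.position e + 1) = G.bar (G.rot e) := by
    rw [boundaryEdge_succ, boundaryEdge_position]
  have hpos := G.boundaryEdge_position (G.bar (G.rot e))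
  refine le_antisymm (hnext ▸ G.position_boundaryEdge_le _) ?_
  rcases hq : G.position (G.bar (G.rot e)) with _ | q
  · rw [hq] at hpos
    have htail : G.tail = G.bar (G.rot e) := hpos
    exact absurd (by rw [htail, G.bar_bar]) (rot_ne_bar_tail he)
  · rw [hq, boundaryEdge_succ] at hpos
    rw [← G.rot.injective (G.bar.injective hpos)]
    exact Nat.succ_le_succ (G.position_boundaryEdge_le q)

end Boundary

section Ell

theorem coeff_ell (n : ℕ) (x : G.Dart) : coeff n (G.ell x) = G.ellComp n x :=
  coeff_mk _ _

theorem ellComp_zero (x : G.Dart) : G.ellComp 0 x = 0 := by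
  rw [ellComp, if_pos rfl]

theorem ellComp_one (x : G.Dart) :
    G.ellComp 1 x = TensorAlgebra.ι ℚ (homologyClass (G.mark x)) := by
  rw [ellComp, if_neg one_ne_zero, if_pos rfl]

theorem coeff_zero_ell (x : G.Dart) : coeff 0 (G.ell x) = 0 := by
  rw [coeff_ell, ellComp_zero]

theorem coeff_zero_neg_ell (x : G.Dart) : coeff 0 (-G.ell x) = 0 := by
  rw [map_neg, coeff_zero_ell, neg_zero]

theorem ellComp_of_two_le (hn : 2 ≤ n) (x : G.Dart) :
    G.ellComp n x =
      let S y := (-(1 / 3) : ℚ) •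
        G.pathSum (fun f f' => coeff n (hausdorff (G.ell f) (-G.ell f'))) y
      if G.position x < G.position (G.bar x) then S x else -S (G.bar x) := by
  have hlower (f : G.Dart) :
      truncCon _ n (PowerSeries.mk fun k => if k < n then G.ellComp k f else 0) (G.ell f) :=
    fun k hk => by rw [coeff_mk, if_pos hk, coeff_ell]
  have hzero (f : G.Dart) :
      coeff 0 (PowerSeries.mk fun k => if k < n then G.ellComp k f else 0) = 0 := by
    rw [coeff_mk, ellComp_zero, ite_self]
  have hcongr (f f' : G.Dart) :=
    coeff_hausdorff_congr (hzero f) (G.coeff_zero_ell f)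
      (by rw [map_neg, hzero f', neg_zero]) (G.coeff_zero_neg_ell f') (hlower f)
      ((truncCon (Tensors g) n).neg (hlower f'))
  rw [ellComp, if_neg (by omega), if_neg (by omega)]
  simp only [dite_eq_ite, hcongr]

theorem mark_bar_eq_inv (x : G.Dart) : G.mark (G.bar x) = (G.mark x)⁻¹ :=
  eq_inv_of_mul_eq_one_left (G.mark_bar x)

theorem ellComp_bar (n : ℕ) (x : G.Dart) : G.ellComp n (G.bar x) = -G.ellComp n x := by
  match n with
  | 0 => rw [ellComp_zero, ellComp_zero, neg_zero]
  | 1 => rw [ellComp_one, ellComp_one, mark_bar_eq_inv, homologyClass_inv, map_neg]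
  | n + 2 =>
    rw [ellComp_of_two_le G (by omega), ellComp_of_two_le G (by omega), G.bar_bar]
    rcases lt_or_gt_of_ne (G.position_bar_ne x) with h | h
    · rw [if_pos h, if_neg h.not_gt, neg_neg]
    · rw [if_neg h.not_gt, if_pos h]

theorem ell_bar (x : G.Dart) : G.ell (G.bar x) = -G.ell x :=
  PowerSeries.ext fun k => by rw [map_neg, coeff_ell, coeff_ell, ellComp_bar]

theorem expSeries_bar (x : G.Dart) :
    expSeries (G.ell (G.bar x)) * expSeries (G.ell x) = 1 := by
  rw [ell_bar, expSeries_neg_mul (G.coeff_zero_ell x)]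

/-- The degree `n` component of `h(ℓ(x), ℓ(y))`, where `y` follows `x` in the cyclic order at a
vertex. Since `-ℓ(ȳ) = ℓ(y)`, these corner terms are the summands in the recursive definition of
`ℓ`. -/
def corner (n : ℕ) (x : G.Dart) : Tensors g :=
  coeff n (hausdorff (G.ell x) (G.ell (G.rot x)))

theorem ellComp_eq_sub (hn : 2 ≤ n) (x : G.Dart) :
    G.ellComp n x = (1 / 3 : ℚ) •
      (∑ j ∈ Finset.range (G.position x), G.corner n (G.boundaryEdge j) -
        ∑ j ∈ Finset.range (G.position (G.bar x)), G.corner n (G.boundaryEdge j)) := by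
  have hcorner (j) : coeff n (hausdorff (G.ell (G.boundaryEdge j))
      (-G.ell (G.boundaryEdge (j + 1)))) = G.corner n (G.boundaryEdge j) := by
    rw [boundaryEdge_succ, ell_bar, neg_neg, corner]
  rw [ellComp_of_two_le G hn]
  simp only [pathSum, hcorner]
  split_ifs with hlt
  · rw [Finset.sum_Ico_eq_sub _ hlt.le, neg_smul, ← smul_neg, neg_sub]
  · rw [G.bar_bar, Finset.sum_Ico_eq_sub _ (not_lt.1 hlt), neg_smul, neg_neg]

theorem ell_homogeneous (x : G.Dart) : IsHomogeneous (G.ell x) := by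
  intro n
  rw [coeff_ell]
  induction n using Nat.strong_induction_on generalizing x with
  | _ n ih =>
    match n with
    | 0 => rw [ellComp_zero]; exact zero_mem _
    | 1 =>
      rw [ellComp_one, pow_one]
      exact LinearMap.mem_range_self _ _
    | n + 2 =>
      have hlower (y) (k) (hk : k < n + 2) : coeff k (G.ell y) ∈ tensorDegree g k := by
        rw [coeff_ell]
        exact ih k hk y
      have hcorner (y) : G.corner (n + 2) y ∈ tensorDegree g (n + 2) :=
        coeff_hausdorff_mem (G.coeff_zero_ell _) (G.coeff_zero_ell _) (hlower _) (hlower _)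
      rw [ellComp_eq_sub G (by omega)]
      exact Submodule.smul_mem _ _
        (sub_mem (sum_mem fun j _ => hcorner _) (sum_mem fun j _ => hcorner _))

variable {G} in
theorem ellComp_vertex_one (he : e ≠ G.bar G.tail) :
    G.ellComp 1 e + G.ellComp 1 (G.rot e) + G.ellComp 1 (G.rot (G.rot e)) = 0 := by
  rw [ellComp_one, ellComp_one, ellComp_one, ← map_add, ← map_add, ← homologyClass_mul,
    ← homologyClass_mul, G.mark_vertex e he, homologyClass_one, map_zero]

variable {G} in
/-- Each of the three oriented edges `x` at the vertex contributes the difference between the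
positions of `x` and of the reverse of the next edge, which is the single corner at `x`. -/
theorem ellComp_vertex (hn : n ≠ 0) (he : e ≠ G.bar G.tail)
    (hcorner : ∀ x ≠ G.bar G.tail, G.corner n (G.rot x) = G.corner n x) :
    G.ellComp n e + G.ellComp n (G.rot e) + G.ellComp n (G.rot (G.rot e)) + G.corner n e = 0 := by
  rcases eq_or_ne n 1 with rfl | hn1
  · rw [ellComp_vertex_one he, corner, coeff_one_hausdorff, add_zero]
  have hn2 : 2 ≤ n := by omega
  have he₁ := rot_ne_bar_tail he
  have he₂ := rot_ne_bar_tail he₁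
  have hpos₀ := position_bar_rot he
  have hpos₁ := position_bar_rot he₁
  have hpos₂ := position_bar_rot he₂
  rw [G.trivalent e he] at hpos₂
  rw [ellComp_eq_sub G hn2, ellComp_eq_sub G hn2, ellComp_eq_sub G hn2, hpos₀, hpos₁, hpos₂,
    Finset.sum_range_succ, Finset.sum_range_succ, Finset.sum_range_succ, boundaryEdge_position,
    boundaryEdge_position, boundaryEdge_position, hcorner _ he₁, hcorner _ he]
  module

/-- The product of the exponentials of `ℓ` around a vertex, starting at `e`. -/
def vertexProd (e : G.Dart) : TensorSeries g :=
  expSeries (G.ell e) * expSeries (G.ell (G.rot e)) * expSeries (G.ell (G.rot (G.rot e)))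

theorem coeff_vertexProd (hn : n ≠ 0) (h : truncCon _ n (G.vertexProd e) 1) :
    coeff n (G.vertexProd e) = G.ellComp n e + G.ellComp n (G.rot e) +
      G.ellComp n (G.rot (G.rot e)) + G.corner n e := by
  simpa only [coeff_ell, vertexProd, corner] using coeff_expSeries_mul_mul (G.coeff_zero_ell _) hn h

variable {G} in
theorem coeff_vertexProd_rot (he : e ≠ G.bar G.tail) (h : truncCon _ n (G.vertexProd e) 1)
    (hrot : truncCon _ n (G.vertexProd (G.rot e)) 1) :
    coeff n (G.vertexProd (G.rot e)) = coeff n (G.vertexProd e) := by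
  rw [vertexProd, G.trivalent e he] at hrot ⊢
  rw [vertexProd, mul_assoc] at h
  rw [vertexProd, mul_assoc (expSeries (G.ell e))]
  exact (coeff_mul_comm_of_truncCon h hrot (coeff_zero_expSeries _)).symm

variable {G} in
theorem vertexProd_eq_one (he : e ≠ G.bar G.tail) : G.vertexProd e = 1 := by
  refine eq_of_forall_truncCon fun n => ?_
  induction n generalizing e with
  | zero => exact truncCon_zero
  | succ n ih =>
    rw [truncCon_succ_iff]
    refine ⟨ih he, ?_⟩
    rcases eq_or_ne n 0 with rfl | hn
    · rw [vertexProd, coeff_zero_mul, coeff_zero_expSeries_mul, coeff_zero_expSeries, one_mul,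
        coeff_zero_one]
    have hcorner (x) (hx : x ≠ G.bar G.tail) : G.corner n (G.rot x) = G.corner n x := by
      have hcyclic := coeff_vertexProd_rot hx (ih hx) (ih (rot_ne_bar_tail hx))
      rw [G.coeff_vertexProd hn (ih hx), G.coeff_vertexProd hn (ih (rot_ne_bar_tail hx)),
        G.trivalent x hx, add_assoc (G.ellComp n x), add_comm (G.ellComp n x)] at hcyclic
      exact add_left_cancel hcyclic
    rw [G.coeff_vertexProd hn (ih he), ellComp_vertex hn he hcorner, PowerSeries.coeff_one,
      if_neg hn]

end Ell

section Cocycles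

/-- The rational functions on the oriented edges that satisfy the additive versions of the
relations of a marking: the cellular 1-cocycles of the surface. -/
def cocycles : Submodule ℚ (G.Dart → ℚ) where
  carrier := {α | (∀ e, α (G.bar e) = -α e) ∧
    ∀ e ≠ G.bar G.tail, α e + α (G.rot e) + α (G.rot (G.rot e)) = 0}
  add_mem' := fun {a b} ha hb => ⟨fun e => by simp [ha.1 e, hb.1 e, add_comm], fun e he => by
    simp only [Pi.add_apply]; linear_combination ha.2 e he + hb.2 e he⟩
  zero_mem' := ⟨fun _ => by simp, fun _ _ => by simp⟩
  smul_mem' := fun c a ha => ⟨fun e => by simp [ha.1 e], fun e he => by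
    simp only [Pi.smul_apply, smul_eq_mul]; linear_combination c * ha.2 e he⟩

variable {G} {α β : G.Dart → ℚ}

/-- At the univalent vertex this holds because the sum over all oriented edges vanishes. -/
theorem vertex_sum_of_mem_cocycles (hα : α ∈ G.cocycles) (e : G.Dart) :
    α e + α (G.rot e) + α (G.rot (G.rot e)) = 0 := by
  have := G.finite_dart
  have := Fintype.ofFinite G.Dart
  by_cases he : e = G.bar G.tail
  · have htotal : ∑ x, α x = 0 := by
      refine self_eq_neg.1 ?_
      rw [← Finset.sum_neg_distrib, ← Equiv.sum_comp G.bar]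
      exact Finset.sum_congr rfl fun x _ => hα.1 x
    have hvertices : ∑ x, (α x + α (G.rot x) + α (G.rot (G.rot x))) = 0 := by
      rw [Finset.sum_add_distrib, Finset.sum_add_distrib,
        Equiv.sum_comp G.rot (fun x => α (G.rot x)), Equiv.sum_comp G.rot α, htotal,
        add_zero, add_zero]
    rw [he]
    rwa [Finset.sum_eq_single (G.bar G.tail) (fun x _ hx => hα.2 x hx) (by simp)] at hvertices
  · exact hα.2 e he

theorem dotProduct_eq_zero_of_mem_invariants_rot [Fintype G.Dart] (hα : α ∈ G.cocycles)
    (hβ : β ∈ invariants ℚ G.rot) : α ⬝ᵥ β = 0 := by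
  have hβ : β ∘ G.rot = β := hβ
  have hrot (γ : G.Dart → ℚ) : (γ ∘ G.rot) ⬝ᵥ β = γ ⬝ᵥ β := by
    conv_lhs => rw [← hβ]
    exact comp_equiv_dotProduct_comp_equiv γ β G.rot
  have hsum : (α + α ∘ G.rot + (α ∘ G.rot) ∘ G.rot) ⬝ᵥ β = 0 := by
    rw [show α + α ∘ G.rot + (α ∘ G.rot) ∘ G.rot = 0 from
      funext (vertex_sum_of_mem_cocycles hα), zero_dotProduct]
  rw [add_dotProduct, add_dotProduct, hrot (α ∘ G.rot), hrot α] at hsum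
  linarith

theorem dotProduct_eq_zero_of_mem_invariants_bar [Fintype G.Dart] (hα : α ∈ G.cocycles)
    (hβ : β ∈ invariants ℚ G.bar) : α ⬝ᵥ β = 0 := by
  have hβ : β ∘ G.bar = β := hβ
  have hbar := comp_equiv_dotProduct_comp_equiv α β G.bar
  rw [hβ, show α ∘ G.bar = -α from funext hα.1, neg_dotProduct] at hbar
  exact self_eq_neg.1 hbar.symm

variable (G)

theorem disjoint_cocycles_invariants :
    Disjoint G.cocycles (invariants ℚ G.rot ⊔ invariants ℚ G.bar) := by
  have := G.finite_dart
  have := Fintype.ofFinite G.Dart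
  rw [Submodule.disjoint_def]
  intro α hα hα'
  obtain ⟨β, hβ, γ, hγ, hsum⟩ := Submodule.mem_sup.1 hα'
  rw [← dotProduct_self_eq_zero]
  nth_rw 2 [← hsum]
  rw [dotProduct_add, dotProduct_eq_zero_of_mem_invariants_rot hα hβ,
    dotProduct_eq_zero_of_mem_invariants_bar hα hγ, add_zero]

theorem finrank_invariants_inf_le :
    Module.finrank ℚ (invariants ℚ G.rot ⊓ invariants ℚ G.bar : Submodule ℚ (G.Dart → ℚ)) ≤ 1 := by
  have := G.finite_dart
  refine (Submodule.finrank_mono (t := Submodule.span ℚ {fun _ => 1}) ?_).trans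
    ((finrank_span_le_card _).trans (by simp))
  rintro β ⟨hrot, hbar⟩
  refine Submodule.mem_span_singleton.2 ⟨β G.tail, funext fun e => ?_⟩
  obtain ⟨n, rfl⟩ := G.one_boundary e
  change β G.tail * 1 = β (G.boundaryEdge n)
  rw [mul_one]
  induction n with
  | zero => rfl
  | succ n ih =>
    rw [G.boundaryEdge_succ, show β (G.bar _) = β _ from congrFun hbar _,
      show β (G.rot _) = β _ from congrFun hrot _, ih]

theorem finrank_cocycles_le : Module.finrank ℚ G.cocycles ≤ 2 * g := by
  have := G.finite_dart
  have := Fintype.ofFinite G.Dart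
  have hdisj := Submodule.finrank_add_finrank_le_of_disjoint G.disjoint_cocycles_invariants
  have hsup := Submodule.finrank_sup_add_finrank_inf_eq (invariants ℚ G.rot) (invariants ℚ G.bar)
  have hinf := G.finrank_invariants_inf_le
  have hgenus := G.genus
  rw [finrank_invariants, finrank_invariants] at hsup
  rw [Module.finrank_fintype_fun_eq_card, ← Nat.card_eq_fintype_card,
    card_eq_two_mul_card_quotient G.bar_bar G.bar_ne] at hdisj
  omega

end Cocycles

section Characters

/-- The rational character of the surface group with given values on the free generators. -/
def character (c : Fin g ⊕ Fin g → ℚ) : SurfaceGroup g →* Multiplicative ℚ :=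
  FreeGroup.lift fun i => Multiplicative.ofAdd (c i)

/-- The cocycle of a rational character: its values on the marking. -/
def characterValues : (Fin g ⊕ Fin g → ℚ) →ₗ[ℚ] (G.Dart → ℚ) :=
  LinearMap.pi fun e => AddMonoidHom.toRatLinearMap
    (AddMonoidHom.mk' (fun c => (character c (G.mark e)).toAdd) fun c c' => by
      have hmul : character (c + c') = character c * character c' := by
        ext i
        simp [character]
      rw [hmul]
      rfl)

theorem characterValues_mem_cocycles (c : Fin g ⊕ Fin g → ℚ) :
    G.characterValues c ∈ G.cocycles := by
  refine ⟨fun e => ?_, fun e he => ?_⟩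
  · change (character c (G.mark (G.bar e))).toAdd = -(character c (G.mark e)).toAdd
    rw [G.mark_bar_eq_inv, map_inv, toAdd_inv]
  · have hvertex := congrArg (character c) (G.mark_vertex e he)
    rwa [map_mul, map_mul, map_one] at hvertex

theorem characterValues_injective : Function.Injective G.characterValues := by
  refine (injective_iff_map_eq_zero _).2 fun c hc => ?_
  have hone : character c = 1 := by
    refine MonoidHom.eq_of_eqOn_dense G.mark_full ?_
    rintro _ ⟨e, rfl⟩
    exact Multiplicative.toAdd.injective (congrFun hc e)
  funext i
  have hi := congrArg Multiplicative.toAdd (DFunLike.congr_fun hone (FreeGroup.of i))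
  rwa [character, FreeGroup.lift_apply_of] at hi

theorem range_characterValues : LinearMap.range G.characterValues = G.cocycles := by
  have := G.finite_dart
  refine Submodule.eq_of_le_of_finrank_le ?_ (G.finrank_cocycles_le.trans ?_)
  · rintro _ ⟨c, rfl⟩
    exact G.characterValues_mem_cocycles c
  · rw [LinearMap.finrank_range_of_inj G.characterValues_injective,
      Module.finrank_fintype_fun_eq_card]
    simp [two_mul]

theorem exists_character_of_mem_cocycles {α : G.Dart → ℚ} (hα : α ∈ G.cocycles) :
    ∃ χ : SurfaceGroup g →* Multiplicative ℚ, ∀ e, (χ (G.mark e)).toAdd = α e := by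
  rw [← range_characterValues] at hα
  obtain ⟨c, rfl⟩ := hα
  exact ⟨character c, fun e => rfl⟩

end Characters

section Existence

/-- The homomorphism induced by the marking on the free group on the oriented edges. -/
def markHom : FreeGroup G.Dart →* SurfaceGroup g := FreeGroup.lift G.mark

/-- The relators of a marking, as elements of the free group on the oriented edges. -/
def relators : Set (FreeGroup G.Dart) :=
  {w | (∃ e, w = .of (G.bar e) * .of e) ∨
    ∃ e ≠ G.bar G.tail, w = .of e * .of (G.rot e) * .of (G.rot (G.rot e))}

theorem markHom_of (e : G.Dart) : G.markHom (.of e) = G.mark e := FreeGroup.lift_apply_of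

theorem markHom_surjective : Function.Surjective G.markHom := by
  rw [← MonoidHom.range_eq_top, markHom, FreeGroup.range_lift_eq_closure, G.mark_full]

theorem exists_section_markHom :
    ∃ s : SurfaceGroup g →* FreeGroup G.Dart, ∀ x, G.markHom (s x) = x := by
  choose p hp using fun i : Fin g ⊕ Fin g => G.markHom_surjective (FreeGroup.of i)
  have hcomp : G.markHom.comp (FreeGroup.lift p) = MonoidHom.id _ := by
    ext i
    simp [hp]
  exact ⟨FreeGroup.lift p, DFunLike.congr_fun hcomp⟩

theorem markHom_eq_one_of_mem_relators {w : FreeGroup G.Dart} (hw : w ∈ G.relators) :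
    G.markHom w = 1 := by
  rcases hw with ⟨e, rfl⟩ | ⟨e, he, rfl⟩
  · rw [map_mul, markHom_of, markHom_of, G.mark_bar]
  · rw [map_mul, map_mul, markHom_of, markHom_of, markHom_of, G.mark_vertex e he]

theorem ker_markHom_le_ker {V : Type*} [AddCommGroup V] [Module ℚ V]
    (δ : FreeGroup G.Dart →* Multiplicative V) (hδ : ∀ w ∈ G.relators, δ w = 1) :
    G.markHom.ker ≤ δ.ker := by
  intro w hw
  refine Multiplicative.toAdd.injective ((Module.forall_dual_apply_eq_zero_iff ℚ _).1 fun l => ?_)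
  let lδ : FreeGroup G.Dart →* Multiplicative ℚ := (AddMonoidHom.toMultiplicative l).comp δ
  have hlδ (w) (hw : w ∈ G.relators) : (lδ w).toAdd = 0 :=
    (congrArg l (congrArg Multiplicative.toAdd (hδ w hw))).trans l.map_zero
  obtain ⟨χ, hχ⟩ := exists_character_of_mem_cocycles G (α := fun e => (lδ (.of e)).toAdd)
    ⟨fun e => by
      have hbar := hlδ _ (.inl ⟨e, rfl⟩)
      rw [map_mul, toAdd_mul] at hbar
      exact eq_neg_of_add_eq_zero_left hbar, fun e he => by
      have hvertex := hlδ _ (.inr ⟨e, he, rfl⟩)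
      rwa [map_mul lδ, map_mul lδ, toAdd_mul, toAdd_mul] at hvertex⟩
  have hfactor : χ.comp G.markHom = lδ := by
    ext e
    rw [MonoidHom.comp_apply, markHom_of, hχ]
  change (lδ w).toAdd = 0
  rw [← hfactor, MonoidHom.comp_apply, hw, map_one, toAdd_one]

/-- The homomorphism `e ↦ exp ℓ(e)` on the free group on the oriented edges. -/
def expHom : FreeGroup G.Dart →* (TensorSeries g)ˣ :=
  FreeGroup.lift fun e =>
    { val := expSeries (G.ell e)
      inv := expSeries (G.ell (G.bar e))
      val_inv := by simpa only [G.bar_bar] using G.expSeries_bar (G.bar e)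
      inv_val := G.expSeries_bar e }

theorem expHom_of (e : G.Dart) : (G.expHom (.of e) : TensorSeries g) = expSeries (G.ell e) := by
  rw [expHom, FreeGroup.lift_apply_of]

theorem coeff_zero_expHom (w : FreeGroup G.Dart) :
    coeff 0 (G.expHom w : TensorSeries g) = 1 := by
  have hone : (Units.map (constantCoeff (R := Tensors g)).toMonoidHom).comp G.expHom = 1 := by
    ext e
    simpa [expHom_of] using coeff_zero_expSeries (G.ell e)
  rw [coeff_zero_eq_constantCoeff_apply]
  exact congrArg Units.val (DFunLike.congr_fun hone w)

theorem expHom_eq_one_of_mem_relators {w : FreeGroup G.Dart} (hw : w ∈ G.relators) :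
    (G.expHom w : TensorSeries g) = 1 := by
  rcases hw with ⟨e, rfl⟩ | ⟨e, he, rfl⟩
  · rw [map_mul, Units.val_mul, expHom_of, expHom_of, G.expSeries_bar]
  · rw [map_mul, map_mul, Units.val_mul, Units.val_mul, expHom_of, expHom_of, expHom_of]
    exact vertexProd_eq_one he

theorem exists_hom_mark_eq_expSeries :
    ∃ θ : SurfaceGroup g →* TensorSeries g, ∀ e, θ (G.mark e) = expSeries (G.ell e) := by
  obtain ⟨s, hs⟩ := G.exists_section_markHom
  let T : FreeGroup G.Dart →* TensorSeries g := (Units.coeHom _).comp G.expHom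
  refine ⟨T.comp s, fun e => ?_⟩
  rw [← expHom_of, ← markHom_of]
  exact map_section_of_relators (T := T) hs (fun _ => G.markHom_eq_one_of_mem_relators)
    G.ker_markHom_le_ker G.coeff_zero_expHom (fun _ => G.expHom_eq_one_of_mem_relators) (.of e)

theorem mark_induction {p : SurfaceGroup g → Prop} (hmark : ∀ e, p (G.mark e))
    (hmul : ∀ x y, p x → p y → p (x * y)) (x : SurfaceGroup g) : p x := by
  have hx : x ∈ Subgroup.closure (Set.range G.mark) := G.mark_full ▸ Subgroup.mem_top x
  induction hx using Subgroup.closure_induction'' with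
  | mem _ hx =>
    obtain ⟨e, rfl⟩ := hx
    exact hmark e
  | inv_mem _ hx =>
    obtain ⟨e, rfl⟩ := hx
    exact G.mark_bar_eq_inv e ▸ hmark _
  | one => exact G.mark_bar G.tail ▸ hmul _ _ (hmark _) (hmark _)
  | mul x y _ _ hx hy => exact hmul x y hx hy

variable {G} {θ : SurfaceGroup g →* TensorSeries g}

theorem isMagnusExpansion_of_mark (h : ∀ e, θ (G.mark e) = expSeries (G.ell e)) :
    IsMagnusExpansion θ := by
  have hzero (x) : coeff 0 (θ x) = 1 := by
    refine G.mark_induction (p := fun x => coeff 0 (θ x) = 1) (fun e => ?_)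
      (fun x y hx hy => ?_) x
    · rw [h, coeff_zero_expSeries]
    · rw [map_mul, coeff_zero_mul, hx, hy, mul_one]
  have htrunc (x) : truncCon _ 1 (θ x) 1 :=
    truncCon_one_iff.2 (by rw [hzero, coeff_zero_one])
  refine ⟨G.mark_induction (fun e => ?_) (fun x y hx hy => ?_), hzero,
    G.mark_induction (fun e => ?_) (fun x y hx hy => ?_)⟩
  · exact h e ▸ (G.ell_homogeneous e).expSeries
  · exact map_mul θ x y ▸ hx.mul hy
  · rw [h, coeff_one_expSeries, coeff_ell, ellComp_one]
  · rw [coeff_map_mul hzero one_ne_zero (htrunc x) (htrunc y), hx, hy, homologyClass_mul, map_add]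

variable (G)

theorem existsUnique_isFatgraphMagnus :
    ∃! θ : SurfaceGroup g →* TensorSeries g, G.IsFatgraphMagnus θ := by
  obtain ⟨θ, hθ⟩ := G.exists_hom_mark_eq_expSeries
  refine ⟨θ, ⟨isMagnusExpansion_of_mark hθ, hθ⟩, fun θ' hθ' => ?_⟩
  refine MonoidHom.eq_of_eqOn_dense G.mark_full ?_
  rintro _ ⟨e, rfl⟩
  rw [hθ'.2, hθ]

theorem isFatgraphMagnus_magnus : G.IsFatgraphMagnus G.magnus :=
  Classical.epsilon_spec G.existsUnique_isFatgraphMagnus.exists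

end Existence

section Naturality

variable {G} {G' : MarkedFatgraph g} (ψ : G.Dart ≃ G'.Dart)

theorem map_boundaryEdge (hbar : ∀ x, ψ (G.bar x) = G'.bar (ψ x))
    (hrot : ∀ x, ψ (G.rot x) = G'.rot (ψ x)) (j : ℕ) :
    ψ (G.boundaryEdge j) = G'.boundaryEdge j := by
  induction j with
  | zero =>
    have hfixed : G'.rot (ψ (G.bar G.tail)) = ψ (G.bar G.tail) := by rw [← hrot, rot_bar_tail]
    have htail := (G'.univalent_iff _).1 hfixed
    rw [hbar] at htail
    exact G'.bar.injective htail
  | succ j ih => rw [boundaryEdge_succ, boundaryEdge_succ, hbar, hrot, ih]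

theorem position_map (hbar : ∀ x, ψ (G.bar x) = G'.bar (ψ x))
    (hrot : ∀ x, ψ (G.rot x) = G'.rot (ψ x)) (x : G.Dart) :
    G'.position (ψ x) = G.position x := by
  simp only [position, ← map_boundaryEdge ψ hbar hrot, EmbeddingLike.apply_eq_iff_eq]

theorem ell_map (hbar : ∀ x, ψ (G.bar x) = G'.bar (ψ x))
    (hrot : ∀ x, ψ (G.rot x) = G'.rot (ψ x))
    (hmark : ∀ x, homologyClass (G'.mark (ψ x)) = homologyClass (G.mark x)) (x : G.Dart) :
    G'.ell (ψ x) = G.ell x := by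
  ext n
  rw [coeff_ell, coeff_ell]
  induction n using Nat.strong_induction_on generalizing x with
  | _ n ih =>
    match n with
    | 0 => rw [ellComp_zero, ellComp_zero]
    | 1 => rw [ellComp_one, ellComp_one, hmark]
    | n + 2 =>
      have hlower (y) : truncCon _ (n + 2) (G'.ell (ψ y)) (G.ell y) := fun k hk => by
        rw [coeff_ell, coeff_ell, ih k hk]
      have hcorner (j) : G'.corner (n + 2) (G'.boundaryEdge j) =
          G.corner (n + 2) (G.boundaryEdge j) := by
        rw [← map_boundaryEdge ψ hbar hrot, corner, corner, ← hrot]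
        exact coeff_hausdorff_congr (coeff_zero_ell _ _) (coeff_zero_ell _ _)
          (coeff_zero_ell _ _) (coeff_zero_ell _ _) (hlower _) (hlower _)
      rw [ellComp_eq_sub G' (by omega), ellComp_eq_sub G (by omega), ← hbar,
        position_map ψ hbar hrot, position_map ψ hbar hrot]
      simp only [hcorner]

variable {φ : mappingClassGroup g}

theorem magnus_apply_of_iso_act (hφ : ∀ x, homologyClass (φ.1 x) = homologyClass x)
    (hG' : G'.Iso (G.act φ)) (x : SurfaceGroup g) : G'.magnus (φ.1 x) = G.magnus x := by
  obtain ⟨ψ, hbar, hrot, hmark⟩ : ∃ ψ : G'.Dart ≃ G.Dart, (∀ e, ψ (G'.bar e) = G.bar (ψ e)) ∧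
    (∀ e, ψ (G'.rot e) = G.rot (ψ e)) ∧ ∀ e, φ.1 (G.mark (ψ e)) = G'.mark e := hG'
  have hell (e) : G.ell (ψ e) = G'.ell e :=
    ell_map (G' := G) ψ hbar hrot (fun e => by rw [← hmark, hφ]) e
  have hcomp : G'.magnus.comp φ.1.toMonoidHom = G.magnus := by
    refine MonoidHom.eq_of_eqOn_dense G.mark_full ?_
    rintro _ ⟨e, rfl⟩
    obtain ⟨e, rfl⟩ := ψ.surjective e
    change G'.magnus (φ.1 (G.mark (ψ e))) = G.magnus (G.mark (ψ e))
    rw [hmark, G'.isFatgraphMagnus_magnus.2, G.isFatgraphMagnus_magnus.2, hell]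
  exact DFunLike.congr_fun hcomp x

theorem johnson_apply_homologyClass {m : ℕ} (hm : 1 ≤ m) (hφ : φ ∈ torelli g m)
    (hG' : G'.Iso (G.act φ)) (x : SurfaceGroup g) :
    johnson m φ (homologyClass x) = G.magnusComp (m + 1) x - G'.magnusComp (m + 1) x := by
  have hθ := G'.isFatgraphMagnus_magnus.1
  have hφ₁ := homologyClass_of_mem_torelli hm hφ
  have hτ := isJohnson_johnson (existsUnique_isJohnson hθ hφ).exists
  rw [hτ.apply_homologyClass hθ, magnus_apply_of_iso_act hφ₁ hG', magnusComp, magnusComp]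

end Naturality

end MarkedFatgraph

end FatgraphJohnson

end

open FatgraphJohnson in
theorem corollary4p3_general (g : ℕ) (m : ℕ) (hm : 1 ≤ m)
    (φ : mappingClassGroup g) (hφ : φ ∈ torelli g m)
    (k : ℕ) (G : Fin (k + 1) → MarkedFatgraph g)
    (hG : (G (Fin.last k)).Iso ((G 0).act φ)) :
    (∃! τ : Homology g →ₗ[ℚ] Tensors g, IsJohnson m φ τ) ∧
    (∀ i : Fin (k + 1), ∃! θ : SurfaceGroup g →* TensorSeries g, (G i).IsFatgraphMagnus θ) ∧
    ∀ x : SurfaceGroup g,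
      johnson m φ (homologyClass x) =
        ∑ i : Fin k, ((G i.castSucc).magnusComp (m + 1) x - (G i.succ).magnusComp (m + 1) x) := by
  refine ⟨existsUnique_isJohnson (G 0).isFatgraphMagnus_magnus.1 hφ,
    fun i => (G i).existsUnique_isFatgraphMagnus, fun x => ?_⟩
  rw [MarkedFatgraph.johnson_apply_homologyClass hm hφ hG, Finset.sum_sub_distrib,
    sub_eq_sub_iff_add_eq_add]
  exact (Fin.sum_univ_succ fun i => (G i).magnusComp (m + 1) x).symm.trans
    (Fin.sum_univ_castSucc fun i => (G i).magnusComp (m + 1) x)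

/-- The first two parts of the conclusion say that `τ_m(φ)` and the fatgraph Magnus expansions
are well defined; the last one is the formula. -/
theorem corollary4p3 (g : ℕ) (hg : 0 < g) (m : ℕ) (hm : 1 ≤ m)
    (φ : FatgraphJohnson.mappingClassGroup g) (hφ : φ ∈ FatgraphJohnson.torelli g m)
    (k : ℕ) (G : Fin (k + 1) → FatgraphJohnson.MarkedFatgraph g)
    (hW : ∀ i : Fin k, (G i.castSucc).IsWhiteheadMove (G i.succ))
    (hG : (G (Fin.last k)).Iso ((G 0).act φ)) :
    (∃! τ : FatgraphJohnson.Homology g →ₗ[ℚ] FatgraphJohnson.Tensors g,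
      FatgraphJohnson.IsJohnson m φ τ) ∧
    (∀ i : Fin (k + 1),
      ∃! θ : FatgraphJohnson.SurfaceGroup g →* FatgraphJohnson.TensorSeries g,
        (G i).IsFatgraphMagnus θ) ∧
    ∀ x : FatgraphJohnson.SurfaceGroup g,
      FatgraphJohnson.johnson m φ (FatgraphJohnson.homologyClass x) =
        ∑ i : Fin k, ((G i.castSucc).magnusComp (m + 1) x - (G i.succ).magnusComp (m + 1) x) :=
  corollary4p3_general g m hm φ hφ k G hG
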